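/- Let $\mathbb D$ be the open unit disk in $\mathbb R^2$, $\mathcal E'(\mathbb D)$ the distributions with compact support in $\mathbb D$, and $e_\ell(e^{i\theta})=e^{i\ell\theta}/\sqrt{2\pi}$, $\ell\in\mathbb Z$. Let $\lambda_{0,1}$ be the first positive zero of the Bessel function $J_0$, let $\kappa\in(-\infty,\lambda_{0,1}^2)$ (with $\sqrt\kappa=i\sqrt{|\kappa|}$ if $\kappa<0$), and put $\sigma_\kappa(x)=J_0(\sqrt\kappa|x|)^2$. For $r\ge 0$ let $\phi^\kappa_\ell(r)=J_{|\ell|}(\sqrt\kappa r)/J_{|\ell|}(\sqrt\kappa)$ if $\kappa\ne0$, $\phi^0_\ell(r)=r^{|\ell|}$, and $$\psi^\kappa_\ell(r)=\sqrt\kappa\, r\left(\frac{J_1(\sqrt\kappa r)}{J_0(\sqrt\kappa r)}-\frac{J_{|\ell|+1}(\sqrt\kappa r)}{J_{|\ell|}(\sqrt\kappa r)}\right),$$ understood as $0$ if $\kappa r=0$. A conductivity is a real-valued $\gamma\in L^\infty(\mathbb D)$ with $\gamma\ge c>0$ a.e.; $u^\gamma_g\in H^1(\mathbb D)$ solves $-\nabla\cdot(\gamma\nabla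 u)=0$, $u|_{\mathbb S^1}=g$, and $\langle f,\Lambda_\gamma g\rangle=\int_{\mathbb D}\gamma\nabla u_f\cdot\nabla u_g^\gamma\,dx$ for any $u_f\in H^1(\mathbb D)$ with trace $f$. For real $q\in L^\infty(\mathbb D)$ such that $0$ is not a Dirichlet eigenvalue of $-\Delta+q$, $v^q_g\in H^1(\mathbb D)$ solves $(-\Delta+q)v=0$, $v|_{\mathbb S^1}=g$, and $\Lambda^{\rm S}_q g=\partial_\nu v^q_g$ (defined weakly). All pairings are bilinear pairings of $H^{1/2}(\mathbb S^1)$ with $H^{-1/2}(\mathbb S^1)$. Let $d\Phi_\sigma$ and $d\Phi^{\rm S}_{q_0}$ be the differentials of $\gamma\mapsto\Lambda_\gamma$ at $\sigma$ and of $q\mapsto\Lambda^{\rm S}_q$ at $q_0$, extended complex-linearly to complex-valued $L^\infty(\mathbb D)$, and, for smooth $\sigma$ and $q_0$, to $L^\infty(\mathbb D)+\mathcal E'(\mathbb D)$ by setting, for $T\in\mathcal E'(\mathbb D)$, $$\langle f,d\Phi_\sigma(T)g\rangle=\langle T,\nabla u^\sigma_f\cdot\nabla u^\sigma_g\rangle,\qquad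 \langle f,d\Phi^{\rm S}_{q_0}(T)g\rangle=\langle T,v^{q_0}_f v^{q_0}_g\rangle .$$ For $\ell,m\in\mathbb Z$ define $\mathfrak m^\kappa_{\ell,m}[F]=\langle\overline{e_\ell},d\Phi_{\sigma_\kappa}(F)e_m\rangle$ and $$\mu^\kappa_{\ell,m}[F]=\int_{\mathbb D}F(x)\,\phi^\kappa_\ell(|x|)\phi^\kappa_m(|x|)\overline{e_\ell(\widehat x)}e_m(\widehat x)\,dx,\qquad \widehat x=x/|x|,$$ for $F\in L^\infty(\mathbb D)+\mathcal E'(\mathbb D)$, integrals against elements of $\mathcal E'(\mathbb D)$ being duality pairings. Then: 1. For every $F\in L^\infty(\mathbb D)+\mathcal E'(\mathbb D)$ and all $\ell,m\in\mathbb Z$, $$\mathfrak m^\kappa_{\ell,m}[F]=J_0(\sqrt\kappa)^2\int_{\mathbb D}\frac{F(x)}{\sigma_\kappa(x)}\,\frac{\ell m+(|\ell|+\psi^\kappa_\ell(|x|))(|m|+\psi^\kappa_m(|x|))}{|x|^2}\,\phi^\kappa_\ell(|x|)\phi^\kappa_m(|x|)\overline{e_\ell(\widehat x)}e_m(\widehat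 x)\,dx,$$ where the weight multiplying $F$ extends smoothly across $x=0$ and the integral converges. 2. Let $\gamma\in W^{2,\infty}(\mathbb D)$ be a conductivity with $\gamma|_{\mathbb S^1}=a_\gamma\,\sigma_\kappa|_{\mathbb S^1}$ for some $a_\gamma>0$. If $\gamma^{\rm B}\in W^{2,\infty}(\mathbb D)+\mathcal E'(\mathbb D)$ satisfies $d\Phi_{\sigma_\kappa}(\gamma^{\rm B})=\Lambda_\gamma$, then $\mathfrak m^\kappa_{\ell,m}[\gamma^{\rm B}]=\langle\overline{e_\ell},\Lambda_\gamma e_m\rangle$ for all $\ell,m\in\mathbb Z$ (so the explicit integral in 1, with $F=\gamma^{\rm B}$, has this value too). 3. Let $q\in L^\infty(\mathbb D)$ be real valued such that $0$ is not a Dirichlet eigenvalue of $-\Delta+q$. If $q^{\rm B}\in L^\infty(\mathbb D)+\mathcal E'(\mathbb D)$ satisfies $d\Phi^{\rm S}_{-\kappa}(q^{\rm B}+\kappa)=\Lambda^{\rm S}_q-\Lambda^{\rm S}_{-\kappa}$, then $\mu^\kappa_{\ell,m}[q^{\rm B}+\kappa]=\langle\overline{e_\ell},(\Lambda^{\rm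 S}_q-\Lambda^{\rm S}_{-\kappa})e_m\rangle$ for all $\ell,m\in\mathbb Z$, where the integral defining $\mu^\kappa_{\ell,m}$ converges and its weight extends smoothly across $x=0$. -/

import Mathlib

open MeasureTheory Filter Topology
open scoped ContDiff ENNReal Nat ComplexConjugate

noncomputable section

/-! The plane is identified with `ℂ`; `volume` on `ℂ` is Lebesgue measure, and the partial
derivatives `∂₁, ∂₂` are the real directional derivatives along `1` and `Complex.I`. -/

namespace DiskBorn

/-- The open unit disk. -/
def disk : Set ℂ := Metric.ball 0 1

/-- Lebesgue measure on the open unit disk. -/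
def diskVol : Measure ℂ := volume.restrict disk

/-- Arc-length measure on the unit circle, in the angular coordinate `θ ∈ (-π, π]`. -/
def arcLength : Measure ℝ := volume.restrict (Set.Ioc (-Real.pi) Real.pi)

/-! ### Bessel functions and the background conductivities -/

/-- The Bessel function `J_n` of integer order `n ≥ 0` (an entire function). -/
def besselJ (n : ℕ) (z : ℂ) : ℂ :=
  ∑' k : ℕ, (-1 : ℂ) ^ k / ((k ! : ℂ) * ((k + n)! : ℂ)) * (z / 2) ^ (2 * k + n)

/-- The first positive zero `λ_{0,1}` of `J₀`. -/
def besselZero : ℝ := sInf {t : ℝ | 0 < t ∧ besselJ 0 (t : ℂ) = 0}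

/-- `√κ`, equal to `i √|κ|` when `κ < 0`. -/
def sqrtC (κ : ℝ) : ℂ := (κ : ℂ) ^ (1 / 2 : ℂ)

/-- `σ_κ(x) = J₀(√κ |x|)²`; this number is real for every real `κ`. -/
def sigma (κ : ℝ) (x : ℂ) : ℝ := (besselJ 0 (sqrtC κ * (‖x‖ : ℂ)) ^ 2).re

/-- `φ_ℓ^κ(r)`. -/
def phi (κ : ℝ) (l : ℤ) (r : ℝ) : ℂ :=
  if κ = 0 then (r : ℂ) ^ l.natAbs
  else besselJ l.natAbs (sqrtC κ * (r : ℂ)) / besselJ l.natAbs (sqrtC κ)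

/-- `ψ_ℓ^κ(r)`. For `κ = 0` or `r = 0` the first factor vanishes and the value is `0`. -/
def psi (κ : ℝ) (l : ℤ) (r : ℝ) : ℂ :=
  sqrtC κ * (r : ℂ) *
    (besselJ 1 (sqrtC κ * (r : ℂ)) / besselJ 0 (sqrtC κ * (r : ℂ))
      - besselJ (l.natAbs + 1) (sqrtC κ * (r : ℂ)) / besselJ l.natAbs (sqrtC κ * (r : ℂ)))

/-- The `0`-homogeneous extension `x ↦ e_ℓ(x/|x|)` of `e_ℓ(e^{iθ}) = e^{iℓθ} / √(2π)`. -/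
def eHom (l : ℤ) (x : ℂ) : ℂ := (x / (‖x‖ : ℂ)) ^ l / (Real.sqrt (2 * Real.pi) : ℂ)

/-- The basis function `e_ℓ` on the unit circle. -/
def eCirc (l : ℤ) (z : Circle) : ℂ := (z : ℂ) ^ l / (Real.sqrt (2 * Real.pi) : ℂ)

/-- The complex conjugate of `e_ℓ` on the unit circle. -/
def eCircConj (l : ℤ) (z : Circle) : ℂ := conj (eCirc l z)

/-! ### Sobolev spaces on the disk -/

/-- `g` is the weak derivative of `u` on the disk in the direction `v`. -/
def IsWeakDeriv (v : ℂ) (u g : ℂ → ℂ) : Prop :=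
  ∀ η : ℂ → ℝ, ContDiff ℝ ∞ η → HasCompactSupport η → tsupport η ⊆ disk →
    ∫ x, u x * (fderiv ℝ η x v : ℂ) ∂diskVol = - ∫ x, g x * (η x : ℂ) ∂diskVol

/-- Membership in the Sobolev space `W^{k,p}` of the disk. -/
def MemSobolev (p : ℝ≥0∞) : ℕ → (ℂ → ℂ) → Prop
  | 0, u => MemLp u p diskVol
  | k + 1, u => MemLp u p diskVol ∧
      ∀ v ∈ ({1, Complex.I} : Set ℂ), ∃ g, IsWeakDeriv v u g ∧ MemSobolev p k g

/-- An element of `H¹` of the disk, given by a representative `val` together with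
representatives `d1`, `d2` of its weak partial derivatives. -/
structure H1 where
  val : ℂ → ℂ
  d1 : ℂ → ℂ
  d2 : ℂ → ℂ
  val_mem : MemLp val 2 diskVol
  d1_mem : MemLp d1 2 diskVol
  d2_mem : MemLp d2 2 diskVol
  weak1 : IsWeakDeriv 1 val d1
  weak2 : IsWeakDeriv Complex.I val d2

instance : Nonempty H1 :=
  ⟨{ val := 0, d1 := 0, d2 := 0
     val_mem := MemLp.zero, d1_mem := MemLp.zero, d2_mem := MemLp.zero
     weak1 := by intro η _ _ _; simp
     weak2 := by intro η _ _ _; simp }⟩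

/-- The bilinear (not sesquilinear) product `∇u · ∇w`. -/
def gradDot (u w : H1) (x : ℂ) : ℂ := u.d1 x * w.d1 x + u.d2 x * w.d2 x

/-- `f ∈ L²(S¹)` is the boundary trace of `u ∈ H¹`: some smooth functions converge to `u` in `H¹`
of the disk while their restrictions to the circle converge to `f` in `L²(S¹)`. -/
def HasTrace (u : H1) (f : Circle → ℂ) : Prop :=
  MemLp (fun θ : ℝ => f (Circle.exp θ)) 2 arcLength ∧ ∃ w : ℕ → ℂ → ℂ, (∀ n, ContDiff ℝ ∞ (w n)) ∧
    Tendsto (fun n => eLpNorm (fun x => w n x - u.val x) 2 diskVol) atTop (𝓝 0) ∧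
    Tendsto (fun n => eLpNorm (fun x => fderiv ℝ (w n) x 1 - u.d1 x) 2 diskVol) atTop (𝓝 0) ∧
    Tendsto (fun n => eLpNorm (fun x => fderiv ℝ (w n) x Complex.I - u.d2 x) 2 diskVol)
      atTop (𝓝 0) ∧
    Tendsto (fun n => eLpNorm (fun θ : ℝ => w n (Circle.exp θ : ℂ) - f (Circle.exp θ)) 2 arcLength)
      atTop (𝓝 0)

/-- `H^{1/2}(S¹)`, the space of traces of `H¹` functions. -/
def MemHHalf (f : Circle → ℂ) : Prop := ∃ u : H1, HasTrace u f

/-- `H¹₀`, the functions in `H¹` with vanishing trace. -/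
def MemH10 (u : H1) : Prop := HasTrace u 0

/-- Some `H¹` function with trace `f` (it exists when `f ∈ H^{1/2}`). -/
def extension (f : Circle → ℂ) : H1 := Classical.epsilon fun u => HasTrace u f

/-! ### Distributions with compact support -/

/-- `C^∞` of the open disk. Only the values on the disk matter below. -/
def smoothOn : Submodule ℂ (ℂ → ℂ) where
  carrier := {h | ContDiffOn ℝ ∞ h disk}
  add_mem' := fun ha hb => ContDiffOn.add ha hb
  zero_mem' := contDiffOn_const
  smul_mem' := fun c _ ha => ContDiffOn.const_smul c ha

/-- The space `𝓔'` of distributions with compact support in the disk, as the dual of `C^∞`: linear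
functionals bounded by finitely many derivatives on a compact subset of the disk. -/
structure CompactDistribution where
  toLin : smoothOn →ₗ[ℂ] ℂ
  bounded : ∃ K : Set ℂ, IsCompact K ∧ K ⊆ disk ∧ ∃ (k : ℕ) (C : ℝ), ∀ (h : smoothOn) (M : ℝ),
    (∀ j ≤ k, ∀ x ∈ K, ‖iteratedFDeriv ℝ j (h : ℂ → ℂ) x‖ ≤ M) → ‖toLin h‖ ≤ C * M

/-- `h` agrees almost everywhere on the disk with a function smooth on the disk. -/
def HasSmoothRep (h : ℂ → ℂ) : Prop := ∃ s : smoothOn, (s : ℂ → ℂ) =ᵐ[diskVol] h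

open Classical in
/-- The pairing `⟨T, h⟩` of `T ∈ 𝓔'` with the (unique on the disk) smooth representative of `h`. -/
def CompactDistribution.pair (T : CompactDistribution) (h : ℂ → ℂ) : ℂ :=
  if H : HasSmoothRep h then T.toLin H.choose else 0

/-! ### Dirichlet-to-Neumann maps

An operator `A : H^{1/2}(S¹) → H^{-1/2}(S¹)` is represented by its bilinear form
`(f, g) ↦ ⟨f, A g⟩`. -/

/-- A conductivity on the disk: real valued, essentially bounded, and bounded below by a
positive constant. -/
def IsConductivity (γ : ℂ → ℝ) : Prop :=
  MemLp γ ∞ diskVol ∧ ∃ c : ℝ, 0 < c ∧ ∀ᵐ x ∂diskVol, c ≤ γ x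

/-- `u` is a weak solution of `-∇·(γ∇u) = 0` in the disk with boundary values `g`. -/
def IsCondSol (γ : ℂ → ℝ) (g : Circle → ℂ) (u : H1) : Prop :=
  HasTrace u g ∧ ∀ w : H1, MemH10 w → ∫ x, (γ x : ℂ) * gradDot u w x ∂diskVol = 0

/-- The solution `u_g^γ` of the conductivity equation. -/
def condSol (γ : ℂ → ℝ) (g : Circle → ℂ) : H1 := Classical.epsilon (IsCondSol γ g)

/-- `⟨f, Λ_γ g⟩`. -/
def DtN (γ : ℂ → ℝ) (f g : Circle → ℂ) : ℂ :=
  ∫ x, (γ x : ℂ) * gradDot (extension f) (condSol γ g) x ∂diskVol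

/-- `v` is a weak solution of `(-Δ + q) v = 0` in the disk with boundary values `g`. -/
def IsSchrodingerSol (q : ℂ → ℝ) (g : Circle → ℂ) (v : H1) : Prop :=
  HasTrace v g ∧ ∀ w : H1, MemH10 w →
    ∫ x, (gradDot v w x + (q x : ℂ) * v.val x * w.val x) ∂diskVol = 0

/-- The solution `v_g^q` of the Schrödinger equation. -/
def schrodingerSol (q : ℂ → ℝ) (g : Circle → ℂ) : H1 := Classical.epsilon (IsSchrodingerSol q g)

/-- Zero is not a Dirichlet eigenvalue of `-Δ + q`. -/
def ZeroNotInSpectrum (q : ℂ → ℝ) : Prop :=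
  ∀ v : H1, IsSchrodingerSol q 0 v → v.val =ᵐ[diskVol] 0

/-- `⟨f, Λ^S_q g⟩`, where `Λ^S_q g` is the normal derivative of `v_g^q`, taken weakly. -/
def DtNS (q : ℂ → ℝ) (f g : Circle → ℂ) : ℂ :=
  ∫ x, (gradDot (extension f) (schrodingerSol q g) x
    + (q x : ℂ) * (extension f).val x * (schrodingerSol q g).val x) ∂diskVol

/-! ### Differentials of `γ ↦ Λ_γ` and `q ↦ Λ^S_q`

On real bounded directions these are genuine derivatives of the nonlinear maps, extended
complex-linearly to complex bounded directions. On `𝓔'` they are the extension of the resulting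
formula through the duality of `𝓔'` and `C^∞` (solutions are smooth inside the disk when the
background is). On `F + T`, with `F` bounded and `T ∈ 𝓔'`, one takes the sum. -/

/-- `⟨f, dΦ_σ(h) g⟩` for a real bounded direction `h`. -/
def dPhiReal (σ : ℂ → ℝ) (h : ℂ → ℝ) (f g : Circle → ℂ) : ℂ :=
  deriv (fun ε : ℝ => DtN (fun x => σ x + ε * h x) f g) 0

/-- `⟨f, dΦ_σ(F + T) g⟩`. -/
def dPhi (σ : ℂ → ℝ) (F : ℂ → ℂ) (T : CompactDistribution) (f g : Circle → ℂ) : ℂ :=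
  dPhiReal σ (fun x => (F x).re) f g + Complex.I * dPhiReal σ (fun x => (F x).im) f g
    + T.pair (gradDot (condSol σ f) (condSol σ g))

/-- `⟨f, dΦ^S_{q₀}(h) g⟩` for a real bounded direction `h`. -/
def dPhiSReal (q₀ : ℂ → ℝ) (h : ℂ → ℝ) (f g : Circle → ℂ) : ℂ :=
  deriv (fun ε : ℝ => DtNS (fun x => q₀ x + ε * h x) f g) 0

/-- `⟨f, dΦ^S_{q₀}(F + T) g⟩`. -/
def dPhiS (q₀ : ℂ → ℝ) (F : ℂ → ℂ) (T : CompactDistribution) (f g : Circle → ℂ) : ℂ :=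
  dPhiSReal q₀ (fun x => (F x).re) f g + Complex.I * dPhiSReal q₀ (fun x => (F x).im) f g
    + T.pair (fun x => (schrodingerSol q₀ f).val x * (schrodingerSol q₀ g).val x)

/-- `F + T` is a Born approximation of `γ` at `σ`: `dΦ_σ(F + T) = Λ_γ` as operators from
`H^{1/2}` to `H^{-1/2}`. -/
def IsBornApprox (σ γ : ℂ → ℝ) (F : ℂ → ℂ) (T : CompactDistribution) : Prop :=
  ∀ f g : Circle → ℂ, MemHHalf f → MemHHalf g → dPhi σ F T f g = DtN γ f g

/-- `Q + T` is a Born approximation of the potential `q` at `q₀`: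
`dΦ^S_{q₀}(Q + T - q₀) = Λ^S_q - Λ^S_{q₀}`. -/
def IsBornApproxS (q₀ q : ℂ → ℝ) (Q : ℂ → ℂ) (T : CompactDistribution) : Prop :=
  ∀ f g : Circle → ℂ, MemHHalf f → MemHHalf g →
    dPhiS q₀ (fun x => Q x - (q₀ x : ℂ)) T f g = DtNS q f g - DtNS q₀ f g

/-! ### Moments -/

/-- `∫ (F + T) K`, the integral over the disk being a duality pairing for `T`. -/
def integralPair (F : ℂ → ℂ) (T : CompactDistribution) (K : ℂ → ℂ) : ℂ :=
  ∫ x, F x * K x ∂diskVol + T.pair K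

/-- `∫ (F + T) K` makes sense: the integral converges and `K` is smooth in the disk (up to
removable singularities). -/
def PairingDefined (F : ℂ → ℂ) (K : ℂ → ℂ) : Prop :=
  Integrable (fun x => F x * K x) diskVol ∧ HasSmoothRep K

/-- The weight in the moments `μ^κ_{ℓ,m}`. -/
def muKernel (κ : ℝ) (l m : ℤ) (x : ℂ) : ℂ :=
  phi κ l ‖x‖ * phi κ m ‖x‖ * conj (eHom l x) * eHom m x

/-- The moments `μ^κ_{ℓ,m}[F + T]`. -/
def muMoment (κ : ℝ) (l m : ℤ) (F : ℂ → ℂ) (T : CompactDistribution) : ℂ :=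
  integralPair F T (muKernel κ l m)

/-- The moments `𝔪^κ_{ℓ,m}[F + T] = ⟨ē_ℓ, dΦ_{σ_κ}(F + T) e_m⟩`. -/
def fmMoment (κ : ℝ) (l m : ℤ) (F : ℂ → ℂ) (T : CompactDistribution) : ℂ :=
  dPhi (sigma κ) F T (eCircConj l) (eCirc m)

/-- The explicit Bessel weight of the moments `𝔪^κ_{ℓ,m}` (the origin, where the quotient is
meaningless, is a removable singularity). -/
def fmKernel (κ : ℝ) (l m : ℤ) (x : ℂ) : ℂ :=
  besselJ 0 (sqrtC κ) ^ 2 / (sigma κ x : ℂ)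
    * (((l : ℂ) * (m : ℂ)
        + ((|l| : ℤ) + psi κ l ‖x‖) * ((|m| : ℤ) + psi κ m ‖x‖)) / (‖x‖ : ℂ) ^ 2)
    * phi κ l ‖x‖ * phi κ m ‖x‖ * conj (eHom l x) * eHom m x

end DiskBorn

end

/-!
The moments are derivatives of Dirichlet-to-Neumann forms in the directions `F`, so the content is
that these derivatives exist and are integrals of `F` against products of explicit solutions.

Both problems are instances of the form `∫ (γ ∇u · ∇w + q u w)` (`energy`), with `q = 0` or `γ = 1`.
An element of `H¹` is represented by its jet `(u, ∂₁u, ∂₂u)` in the Hilbert space `L²(𝔻)³`, and the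
trace relation is the closure of the graph of restriction to the circle on smooth functions
(`hasTrace_iff`). Hence the jets of `H¹₀` form a closed subspace `traceZero`, and inequalities and
identities for smooth functions, with their boundary terms, pass to `H¹₀` by continuity
(`closure_induction_smooth`). The only integration by parts needed is the divergence theorem on the
disk (`integral_divergence_disk`), proved in polar coordinates.

If the form is coercive on `H¹₀`, the Lax–Milgram theorem solves the Dirichlet problem for small
perturbations of the coefficients, the solutions depend continuously on the perturbation, and the
boundary form `⟨f, Λ g⟩` has the derivative `∫ (h ∇u_f · ∇u_g + k u_f u_g)` in the direction `(h, k)`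
(`hasDerivAt_energy`, `IsCoerciveForm.hasDerivAt_energy`). Coercivity comes from integrating
`|∇w - w Z|² ≥ 0` for a radial field `Z` (`integral_radial_le`): `Z = -x` gives the Poincaré
inequality, and `Z = ∇p / p` with `p = J₀(√κ' |x|)`, `κ < κ' < λ²`, keeps `-Δ - κ` positive.

Writing `J_n(z) = (z/2)^n B_n(z²)` with `B_n` real on the real line (`besselB`) removes the square
root of `κ` and treats all signs of `κ` at once. The `B_n` are positive below `λ²` (`besselB_pos`),
so the quotients in `φ` and `ψ` have nonzero denominators. The functions `φ_m e_m` and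
`J₀(√κ) φ_m e_m / J₀(√κ |x|)` are of the form `A(|x|²) r^|m| e^{imθ}`, and solve their equations by a
one-variable identity (`isFormSol_separated`). By uniqueness they are the solutions in the
definition of the moments, and splitting gradients into radial and angular parts
(`normSq_mul_gradient_product`) gives the Bessel weight. The assertions on Born approximations
follow by testing the defining operator identity on the functions `e_m`.
-/

noncomputable section

namespace DiskBorn

/-! ### Bessel functions as real entire functions of the squared argument -/

/-- The entire function `B_n` with `J_n(z) = (z/2)^n B_n(z²)`, restricted to the real line. -/
def besselB (n : ℕ) (s : ℝ) : ℝ :=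
  ∑' k : ℕ, (-1 : ℝ) ^ k / ((k ! : ℝ) * ((k + n)! : ℝ)) * (s / 4) ^ k

lemma abs_besselB_coeff_le (n k : ℕ) :
    |(-1 : ℝ) ^ k / ((k ! : ℝ) * ((k + n)! : ℝ))| ≤ 1 / (k ! : ℝ) := by
  rw [abs_div, abs_pow, abs_neg, abs_one, one_pow, abs_of_pos (by positivity)]
  apply one_div_le_one_div_of_le (by positivity)
  have h1 : (1 : ℝ) ≤ ((k + n)! : ℝ) := by exact_mod_cast Nat.succ_le_of_lt (Nat.factorial_pos _)
  have h2 : (0 : ℝ) ≤ (k ! : ℝ) := by positivity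
  nlinarith

lemma summable_besselB (n : ℕ) (s : ℝ) :
    Summable fun k : ℕ => (-1 : ℝ) ^ k / ((k ! : ℝ) * ((k + n)! : ℝ)) * (s / 4) ^ k := by
  refine Summable.of_norm_bounded (Real.summable_pow_div_factorial (|s / 4|)) fun k => ?_
  rw [Real.norm_eq_abs, abs_mul, abs_pow]
  have := mul_le_mul_of_nonneg_right (abs_besselB_coeff_le n k)
    (by positivity : (0 : ℝ) ≤ |s / 4| ^ k)
  calc _ ≤ _ := this
    _ = _ := by ring

lemma hasDerivAt_besselB (n : ℕ) (s : ℝ) :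
    HasDerivAt (besselB n) (-(1 / 4) * besselB (n + 1) s) s := by
  set R : ℝ := |s| + 1 with hR
  have hR0 : 0 ≤ R := by positivity
  let u : ℕ → ℝ := fun k => (k : ℝ) / (k ! : ℝ) * (R / 4) ^ (k - 1) * (1 / 4)
  have hu : Summable u := by
    rw [← summable_nat_add_iff 1]
    refine ((Real.summable_pow_div_factorial (R / 4)).mul_right (1 / 4)).congr fun k => ?_
    simp only [u, Nat.add_sub_cancel, Nat.factorial_succ]
    push_cast
    field_simp
  have key := hasDerivAt_tsum_of_isPreconnected (𝕜 := ℝ) (F := ℝ)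
    (g := fun (k : ℕ) (t : ℝ) => (-1 : ℝ) ^ k / ((k ! : ℝ) * ((k + n)! : ℝ)) * (t / 4) ^ k)
    (g' := fun (k : ℕ) (t : ℝ) =>
      (-1 : ℝ) ^ k / ((k ! : ℝ) * ((k + n)! : ℝ)) * ((k : ℝ) * (t / 4) ^ (k - 1) * (1 / 4)))
    (u := u) (t := Metric.ball 0 R) (y₀ := s) (y := s) hu Metric.isOpen_ball
    (convex_ball _ _).isPreconnected ?_ ?_ (by simp [hR]) (summable_besselB n s) (by simp [hR])
  · refine key.congr_deriv ?_
    have hs : Summable fun k : ℕ =>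
      (-1 : ℝ) ^ k / ((k ! : ℝ) * ((k + n)! : ℝ)) * ((k : ℝ) * (s / 4) ^ (k - 1) * (1 / 4)) := by
      rw [← summable_nat_add_iff 1]
      refine ((summable_besselB (n + 1) s).mul_left (-(1 / 4))).congr fun k => ?_
      simp only [Nat.add_sub_cancel, Nat.factorial_succ, pow_succ,
        show k + 1 + n = k + (n + 1) by ring]
      push_cast
      field_simp
    rw [hs.tsum_eq_zero_add, besselB, ← tsum_mul_left]
    simp only [Nat.cast_zero, zero_mul, mul_zero, zero_add]
    refine tsum_congr fun k => ?_
    simp only [Nat.add_sub_cancel, Nat.factorial_succ k, pow_succ,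
      show k + 1 + n = k + (n + 1) by ring]
    push_cast
    field_simp
  · intro k t _
    have h := (((hasDerivAt_id t).div_const 4).pow k).const_mul
      ((-1 : ℝ) ^ k / ((k ! : ℝ) * ((k + n)! : ℝ)))
    exact h
  · intro k t ht
    have ht' : |t / 4| ≤ R / 4 := by
      rw [abs_div]; simp at ht
      have : |(4 : ℝ)| = 4 := by norm_num
      rw [this]; linarith
    rw [Real.norm_eq_abs, abs_mul, abs_mul, abs_mul, abs_pow, Nat.abs_cast]
    have h1 := abs_besselB_coeff_le n k
    have h2 : |t / 4| ^ (k - 1) ≤ (R / 4) ^ (k - 1) := pow_le_pow_left₀ (abs_nonneg _) ht' _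
    have h3 : |(1 / 4 : ℝ)| = 1 / 4 := by norm_num
    rw [h3]
    calc _ ≤ 1 / (k ! : ℝ) * ((k : ℝ) * (R / 4) ^ (k - 1) * (1 / 4)) := by gcongr
      _ = u k := by simp only [u]; ring

/-- The recurrence `(n+1) B_{n+1} + s B_{n+1}' = B_n`, with the derivative `B_{n+1}' = -B_{n+2}/4`. -/
lemma besselB_rec (n : ℕ) (s : ℝ) :
    besselB n s = (n + 1) * besselB (n + 1) s - s / 4 * besselB (n + 2) s := by
  have h2 : s / 4 * besselB (n + 2) s = - ∑' k : ℕ,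
      (-1 : ℝ) ^ k / ((k ! : ℝ) * ((k + (n + 1))! : ℝ)) * (s / 4) ^ k * k := by
    have hs : Summable fun k : ℕ =>
        (-1 : ℝ) ^ k / ((k ! : ℝ) * ((k + (n + 1))! : ℝ)) * (s / 4) ^ k * k := by
      rw [← summable_nat_add_iff 1]
      refine ((summable_besselB (n + 2) s).mul_left (-(s / 4))).congr fun k => ?_
      simp only [Nat.factorial_succ k, pow_succ, show k + 1 + (n + 1) = k + (n + 2) by ring]
      push_cast
      field_simp
    rw [hs.tsum_eq_zero_add, besselB, ← tsum_mul_left, Nat.cast_zero, mul_zero, zero_add,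
      ← tsum_neg]
    refine tsum_congr fun k => ?_
    simp only [Nat.factorial_succ k, pow_succ, show k + 1 + (n + 1) = k + (n + 2) by ring]
    push_cast
    field_simp
  have hs' : Summable fun k : ℕ =>
      (-1 : ℝ) ^ k / ((k ! : ℝ) * ((k + (n + 1))! : ℝ)) * (s / 4) ^ k * k := by
    rw [← summable_nat_add_iff 1]
    refine ((summable_besselB (n + 2) s).mul_left (-(s / 4))).congr fun k => ?_
    simp only [Nat.factorial_succ k, pow_succ, show k + 1 + (n + 1) = k + (n + 2) by ring]
    push_cast
    field_simp
  rw [h2, sub_neg_eq_add, besselB, besselB, ← tsum_mul_left,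
    ← ((summable_besselB (n + 1) s).mul_left _).tsum_add hs']
  refine tsum_congr fun k => ?_
  rw [show k + (n + 1) = (k + n) + 1 by ring, Nat.factorial_succ]
  push_cast
  field_simp
  ring

lemma contDiff_besselB (n : ℕ) : ContDiff ℝ ∞ (besselB n) := by
  rw [contDiff_infty]
  intro k
  induction k generalizing n with
  | zero =>
    exact contDiff_zero.2
      (continuous_iff_continuousAt.2 fun s => (hasDerivAt_besselB n s).continuousAt)
  | succ k ih =>
    have hd : deriv (besselB n) = fun s => -(1 / 4) * besselB (n + 1) s :=
      funext fun s => (hasDerivAt_besselB n s).deriv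
    have h : ContDiff ℝ ((k : WithTop ℕ∞) + 1) (besselB n) := by
      refine contDiff_succ_iff_deriv.2
        ⟨fun s => (hasDerivAt_besselB n s).differentiableAt, by simp, ?_⟩
      rw [hd]
      exact contDiff_const.mul (ih (n + 1))
    exact_mod_cast h

lemma besselB_pos_of_nonpos (n : ℕ) {s : ℝ} (hs : s ≤ 0) : 0 < besselB n s := by
  have ht : ∀ k : ℕ, (-1 : ℝ) ^ k / ((k ! : ℝ) * ((k + n)! : ℝ)) * (s / 4) ^ k
      = 1 / ((k ! : ℝ) * ((k + n)! : ℝ)) * (-s / 4) ^ k := by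
    intro k
    rw [show -s / 4 = (-1) * (s / 4) by ring, mul_pow]
    ring
  refine (summable_besselB n s).tsum_pos (fun k => ?_) 0 ?_
  · rw [ht]
    have : 0 ≤ -s / 4 := by linarith
    positivity
  · simp; positivity

lemma sqrtC_sq (κ : ℝ) : sqrtC κ ^ 2 = (κ : ℂ) := by
  rw [sqrtC, ← Complex.cpow_nat_mul]
  norm_num

lemma besselJ_eq_of_sq_eq (n : ℕ) {z : ℂ} {s : ℝ} (h : z ^ 2 = (s : ℂ)) :
    besselJ n z = (z / 2) ^ n * (besselB n s : ℂ) := by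
  rw [besselJ, besselB, Complex.ofReal_tsum, ← tsum_mul_left]
  refine tsum_congr fun k => ?_
  rw [pow_add, pow_mul, div_pow z 2 2, h]
  push_cast
  ring

lemma besselJ_sqrtC_mul (n : ℕ) (κ r : ℝ) :
    besselJ n (sqrtC κ * (r : ℂ)) = (sqrtC κ * r / 2) ^ n * (besselB n (κ * r ^ 2) : ℂ) :=
  besselJ_eq_of_sq_eq n (by rw [mul_pow, sqrtC_sq]; push_cast; ring)

lemma besselZero_nonneg : 0 ≤ besselZero := Real.sInf_nonneg fun _ hx => hx.1.le

/-- Below the square of the first zero of `J₀` all the `B_n` are positive: for `n = 0` by the choice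
of the zero, and then inductively because `(s^{n+1} B_{n+1})' = s^n B_n`. -/
lemma besselB_pos (n : ℕ) {s : ℝ} (hs : s ≤ 0 ∨ s < besselZero ^ 2) : 0 < besselB n s := by
  by_cases h0 : s ≤ 0
  · exact besselB_pos_of_nonpos n h0
  have hsz : s < besselZero ^ 2 := hs.resolve_left h0
  clear hs
  push Not at h0
  induction n generalizing s with
  | zero =>
    by_contra hneg
    push Not at hneg
    obtain ⟨t, ht, htz⟩ : (0 : ℝ) ∈ besselB 0 '' Set.Icc 0 s :=
      intermediate_value_Icc' h0.le (contDiff_besselB 0).continuous.continuousOn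
        ⟨hneg, (besselB_pos_of_nonpos 0 le_rfl).le⟩
    have ht0 : 0 < t := by
      rcases ht.1.lt_or_eq with h | h
      · exact h
      · rw [← h] at htz
        exact absurd htz (besselB_pos_of_nonpos 0 le_rfl).ne'
    have hle : besselZero ≤ √t := by
      refine csInf_le ⟨0, fun x hx => hx.1.le⟩ ⟨Real.sqrt_pos.2 ht0, ?_⟩
      rw [besselJ_eq_of_sq_eq 0 (s := t) (by rw [← Complex.ofReal_pow, Real.sq_sqrt ht0.le]), htz]
      simp
    have : besselZero ^ 2 ≤ t := by
      rw [← Real.sq_sqrt ht0.le]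
      exact pow_le_pow_left₀ besselZero_nonneg hle 2
    linarith [ht.2]
  | succ n ih =>
    have hd : ∀ t : ℝ, HasDerivAt (fun t => t ^ (n + 1) * besselB (n + 1) t)
        (t ^ n * besselB n t) t := by
      intro t
      refine ((hasDerivAt_pow (n + 1) t).mul (hasDerivAt_besselB (n + 1) t)).congr_deriv ?_
      rw [besselB_rec n t]
      simp only [Nat.add_sub_cancel]
      push_cast
      ring
    have hmono : StrictMonoOn (fun t => t ^ (n + 1) * besselB (n + 1) t) (Set.Icc 0 s) := by
      refine strictMonoOn_of_deriv_pos (convex_Icc _ _)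
        (fun t _ => (hd t).continuousAt.continuousWithinAt) fun t ht => ?_
      rw [interior_Icc] at ht
      rw [(hd t).deriv]
      exact mul_pos (pow_pos ht.1 _) (ih (ht.2.trans hsz) ht.1)
    have := hmono ⟨le_rfl, h0.le⟩ ⟨h0.le, le_rfl⟩ h0
    simp only [zero_pow (Nat.succ_ne_zero n), zero_mul] at this
    exact pos_of_mul_pos_right this (by positivity)

lemma besselB_mul_pos (n : ℕ) {κ t : ℝ} (hκ : κ < besselZero ^ 2) (h0 : 0 ≤ t) (h1 : t ≤ 1) :
    0 < besselB n (κ * t) := by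
  refine besselB_pos n ?_
  rcases le_or_gt κ 0 with h | h
  · exact Or.inl (mul_nonpos_of_nonpos_of_nonneg h h0)
  · exact Or.inr ((mul_le_of_le_one_right h.le h1).trans_lt hκ)

lemma besselB_pos_at (n : ℕ) {κ : ℝ} (hκ : κ < besselZero ^ 2) : 0 < besselB n κ :=
  besselB_pos n (Or.inr hκ)

/-! ### The divergence theorem on the disk -/

instance : IsFiniteMeasure diskVol := by
  unfold diskVol disk
  exact ⟨by rw [Measure.restrict_apply_univ]; exact measure_ball_lt_top⟩

instance : IsFiniteMeasure arcLength := by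
  unfold arcLength
  exact ⟨by rw [Measure.restrict_apply_univ]; exact measure_Ioc_lt_top⟩

lemma measurableSet_disk : MeasurableSet disk := Metric.isOpen_ball.measurableSet

lemma isOpen_disk : IsOpen disk := Metric.isOpen_ball

lemma ae_mem_disk : ∀ᵐ x ∂diskVol, x ∈ disk := ae_restrict_mem measurableSet_disk

lemma mem_disk {x : ℂ} : x ∈ disk ↔ ‖x‖ < 1 := by simp [disk]

/-- Integration over the disk in polar coordinates. -/
lemma integral_disk_eq_polar (F : ℂ → ℂ) :
    ∫ x, F x ∂diskVol = ∫ p in Set.Icc ((0 : ℝ), -Real.pi) (1, Real.pi),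
      (p.1 : ℂ) * F (p.1 * Complex.exp (p.2 * Complex.I)) := by
  rw [diskVol, ← integral_indicator measurableSet_disk, ← Complex.integral_comp_polarCoord_symm]
  have hset : (Set.Icc ((0 : ℝ), -Real.pi) (1, Real.pi) : Set (ℝ × ℝ)) =ᵐ[volume]
      (Set.Ioo 0 1 ×ˢ Set.Ioo (-Real.pi) Real.pi : Set (ℝ × ℝ)) := by
    rw [← Set.Icc_prod_Icc, Measure.volume_eq_prod]
    exact Measure.set_prod_ae_eq Ioo_ae_eq_Icc.symm Ioo_ae_eq_Icc.symm
  rw [setIntegral_congr_set hset]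
  have hsub : (Set.Ioo 0 1 ×ˢ Set.Ioo (-Real.pi) Real.pi : Set (ℝ × ℝ)) ⊆ polarCoord.target := by
    rintro ⟨r, θ⟩ ⟨h1, h2⟩
    exact ⟨h1.1, h2⟩
  rw [setIntegral_eq_of_subset_of_forall_sdiff_eq_zero polarCoord.open_target.measurableSet hsub]
  · refine setIntegral_congr_fun (measurableSet_Ioo.prod measurableSet_Ioo) ?_
    rintro ⟨r, θ⟩ ⟨h1, h2⟩
    simp only [Complex.polarCoord_symm_apply]
    rw [Set.indicator_of_mem]
    · rw [Complex.exp_mul_I, Complex.real_smul, Complex.ofReal_cos, Complex.ofReal_sin]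
    · rw [mem_disk, ← Complex.polarCoord_symm_apply (r, θ), Complex.norm_polarCoord_symm,
        abs_of_pos h1.1]
      exact h1.2
  · rintro ⟨r, θ⟩ ⟨h1, h2⟩
    rw [Set.indicator_of_notMem, smul_zero]
    rw [mem_disk, Complex.norm_polarCoord_symm, abs_of_pos h1.1]
    exact fun h => h2 ⟨⟨h1.1, h⟩, h1.2⟩

lemma circle_exp_coe (θ : ℝ) : (Circle.exp θ : ℂ) = Complex.exp (θ * Complex.I) := rfl

/-- The divergence theorem on the disk for `C¹` vector fields, obtained from the divergence theorem
on the rectangle `[0, 1] × [-π, π]` in polar coordinates. -/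
theorem integral_divergence_disk {Y₁ Y₂ : ℂ → ℂ} (h₁ : ContDiff ℝ 1 Y₁) (h₂ : ContDiff ℝ 1 Y₂) :
    ∫ x, (fderiv ℝ Y₁ x 1 + fderiv ℝ Y₂ x Complex.I) ∂diskVol
      = ∫ θ, ((Real.cos θ : ℂ) * Y₁ (Circle.exp θ) + (Real.sin θ : ℂ) * Y₂ (Circle.exp θ))
          ∂arcLength := by
  have hE : ContDiff ℝ 1 fun p : ℝ × ℝ => Complex.exp (p.2 * Complex.I) := by
    have : ContDiff ℝ 1 fun p : ℝ × ℝ => ((p.2 : ℝ) : ℂ) :=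
      Complex.ofRealCLM.contDiff.comp contDiff_snd
    fun_prop
  have hr : ContDiff ℝ 1 fun p : ℝ × ℝ => ((p.1 : ℝ) : ℂ) :=
    Complex.ofRealCLM.contDiff.comp contDiff_fst
  have hP : ContDiff ℝ 1 fun p : ℝ × ℝ => (p.1 : ℂ) * Complex.exp (p.2 * Complex.I) := hr.mul hE
  have hc : ContDiff ℝ 1 fun p : ℝ × ℝ => ((Real.cos p.2 : ℝ) : ℂ) :=
    Complex.ofRealCLM.contDiff.comp (Real.contDiff_cos.comp contDiff_snd)
  have hs : ContDiff ℝ 1 fun p : ℝ × ℝ => ((Real.sin p.2 : ℝ) : ℂ) :=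
    Complex.ofRealCLM.contDiff.comp (Real.contDiff_sin.comp contDiff_snd)
  set f : ℝ × ℝ → ℂ := fun p => (p.1 : ℂ) *
    ((Real.cos p.2 : ℂ) * Y₁ ((p.1 : ℂ) * Complex.exp (p.2 * Complex.I))
      + (Real.sin p.2 : ℂ) * Y₂ ((p.1 : ℂ) * Complex.exp (p.2 * Complex.I))) with hf
  set g : ℝ × ℝ → ℂ := fun p =>
    (Real.cos p.2 : ℂ) * Y₂ ((p.1 : ℂ) * Complex.exp (p.2 * Complex.I))
      - (Real.sin p.2 : ℂ) * Y₁ ((p.1 : ℂ) * Complex.exp (p.2 * Complex.I)) with hg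
  have hfc : ContDiff ℝ 1 f := hr.mul ((hc.mul (h₁.comp hP)).add (hs.mul (h₂.comp hP)))
  have hgc : ContDiff ℝ 1 g := (hc.mul (h₂.comp hP)).sub (hs.mul (h₁.comp hP))
  have hdiv : ∀ p : ℝ × ℝ, fderiv ℝ f p (1, 0) + fderiv ℝ g p (0, 1)
      = (p.1 : ℂ) * (fderiv ℝ Y₁ (p.1 * Complex.exp (p.2 * Complex.I)) 1
        + fderiv ℝ Y₂ (p.1 * Complex.exp (p.2 * Complex.I)) Complex.I) := by
    rintro ⟨r, θ⟩
    have d₁ := fun x => (h₁.differentiable one_ne_zero x).hasFDerivAt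
    have d₂ := fun x => (h₂.differentiable one_ne_zero x).hasFDerivAt
    set e := Complex.exp (θ * Complex.I) with he
    have hrad : HasDerivAt (fun t : ℝ => (t : ℂ) * e) e r := by
      simpa using (Complex.ofRealCLM.hasDerivAt (x := r)).mul_const e
    have hang : HasDerivAt (fun t : ℝ => (r : ℂ) * Complex.exp (t * Complex.I))
        (r * (e * Complex.I)) θ := by
      have := (((Complex.ofRealCLM.hasDerivAt (x := θ)).mul_const Complex.I).cexp).const_mul (r : ℂ)
      simpa using this
    have hf' : fderiv ℝ f (r, θ) (1, 0)
        = 1 * ((Real.cos θ : ℂ) * Y₁ (r * e) + (Real.sin θ : ℂ) * Y₂ (r * e))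
          + r * ((Real.cos θ : ℂ) * fderiv ℝ Y₁ (r * e) e
            + (Real.sin θ : ℂ) * fderiv ℝ Y₂ (r * e) e) := by
      have e1 : HasDerivAt (f ∘ fun t : ℝ => (t, θ)) (fderiv ℝ f (r, θ) (1, 0)) r :=
        ((hfc.differentiable one_ne_zero (r, θ)).hasFDerivAt).comp_hasDerivAt r
          ((hasDerivAt_id r).prodMk (hasDerivAt_const r θ))
      have e2 := (Complex.ofRealCLM.hasDerivAt (x := r)).mul
        ((((d₁ (r * e)).comp_hasDerivAt r hrad).const_mul (Real.cos θ : ℂ)).add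
          (((d₂ (r * e)).comp_hasDerivAt r hrad).const_mul (Real.sin θ : ℂ)))
      simpa using e1.unique e2
    have hg' : fderiv ℝ g (r, θ) (0, 1)
        = -(Real.sin θ : ℂ) * Y₂ (r * e)
            + (Real.cos θ : ℂ) * fderiv ℝ Y₂ (r * e) (r * (e * Complex.I))
          - ((Real.cos θ : ℂ) * Y₁ (r * e)
            + (Real.sin θ : ℂ) * fderiv ℝ Y₁ (r * e) (r * (e * Complex.I))) := by
      have e1 : HasDerivAt (g ∘ fun t : ℝ => (r, t)) (fderiv ℝ g (r, θ) (0, 1)) θ :=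
        ((hgc.differentiable one_ne_zero (r, θ)).hasFDerivAt).comp_hasDerivAt θ
          ((hasDerivAt_const θ r).prodMk (hasDerivAt_id θ))
      have e2 := ((((Real.hasDerivAt_cos θ).ofReal_comp).mul
          ((d₂ (r * e)).comp_hasDerivAt θ hang)).sub
        (((Real.hasDerivAt_sin θ).ofReal_comp).mul ((d₁ (r * e)).comp_hasDerivAt θ hang)))
      simpa using e1.unique e2
    rw [hf', hg']
    have hrI : (r : ℂ) * (e * Complex.I) = r • (e * Complex.I) := by simp
    rw [hrI, map_smul, map_smul]
    -- the rotated frame `e, i e` expresses the standard basis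
    have b1 : (1 : ℂ) = Real.cos θ • e - Real.sin θ • (e * Complex.I) := by
      rw [he, Complex.exp_mul_I, ← Complex.ofReal_cos, ← Complex.ofReal_sin]
      have := Real.cos_sq_add_sin_sq θ
      apply Complex.ext <;> simp [-Complex.ofReal_cos, -Complex.ofReal_sin] <;> nlinarith
    have b2 : Complex.I = Real.sin θ • e + Real.cos θ • (e * Complex.I) := by
      rw [he, Complex.exp_mul_I, ← Complex.ofReal_cos, ← Complex.ofReal_sin]
      have := Real.cos_sq_add_sin_sq θ
      apply Complex.ext <;> simp [-Complex.ofReal_cos, -Complex.ofReal_sin] <;> nlinarith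
    have c1 : fderiv ℝ Y₁ (r * e) 1 = (Real.cos θ : ℂ) * fderiv ℝ Y₁ (r * e) e
        - (Real.sin θ : ℂ) * fderiv ℝ Y₁ (r * e) (e * Complex.I) := by
      conv_lhs => rw [b1, map_sub, map_smul, map_smul]
      simp
    have c2 : fderiv ℝ Y₂ (r * e) Complex.I = (Real.sin θ : ℂ) * fderiv ℝ Y₂ (r * e) e
        + (Real.cos θ : ℂ) * fderiv ℝ Y₂ (r * e) (e * Complex.I) := by
      conv_lhs => rw [b2, map_add, map_smul, map_smul]
      simp
    simp only [c1, c2, Complex.real_smul]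
    ring
  have hpi : -Real.pi ≤ Real.pi := by linarith [Real.pi_pos]
  have key := integral_divergence_prod_Icc_of_hasFDerivAt_of_le f g (fderiv ℝ f) (fderiv ℝ g)
    ((0 : ℝ), -Real.pi) (1, Real.pi) ⟨zero_le_one, hpi⟩ hfc.continuous.continuousOn
    hgc.continuous.continuousOn
    (fun x _ => (hfc.differentiable one_ne_zero x).hasFDerivAt)
    (fun x _ => (hgc.differentiable one_ne_zero x).hasFDerivAt)
    (by
      refine ContinuousOn.integrableOn_compact isCompact_Icc (Continuous.continuousOn ?_)
      exact ((hfc.continuous_fderiv one_ne_zero).clm_apply continuous_const).add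
        ((hgc.continuous_fderiv one_ne_zero).clm_apply continuous_const))
  rw [integral_disk_eq_polar]
  simp only [hdiv] at key
  rw [key]
  have hper : ∀ x : ℝ, g (x, Real.pi) = g (x, -Real.pi) := by
    intro x
    simp only [hg]
    have : Complex.exp (((-Real.pi : ℝ) : ℂ) * Complex.I) = Complex.exp (Real.pi * Complex.I) := by
      rw [Complex.exp_pi_mul_I]; push_cast
      rw [neg_mul, Complex.exp_neg, Complex.exp_pi_mul_I]; norm_num
    simp
  simp only [hper, sub_self, zero_add]
  rw [intervalIntegral.integral_of_le hpi, intervalIntegral.integral_of_le hpi]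
  simp [hf, arcLength]

/-- Smooth functions satisfy the definition of weak derivatives. -/
lemma isWeakDeriv_fderiv {w : ℂ → ℂ} (hw : ContDiff ℝ ∞ w) {v : ℂ}
    (hv : v ∈ ({1, Complex.I} : Set ℂ)) : IsWeakDeriv v w (fun x => fderiv ℝ w x v) := by
  intro η hη _ hsupp
  have hw1 : ContDiff ℝ 1 w := hw.of_le (by simp)
  have hη1 : ContDiff ℝ 1 fun x => (η x : ℂ) :=
    Complex.ofRealCLM.contDiff.comp (hη.of_le (by simp))
  have hY : ContDiff ℝ 1 fun x => w x * (η x : ℂ) := hw1.mul hη1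
  have hb : ∀ θ : ℝ, (η (Circle.exp θ) : ℂ) = 0 := by
    intro θ
    have : (Circle.exp θ : ℂ) ∉ tsupport η := fun h => by
      have := mem_disk.1 (hsupp h)
      simp at this
    rw [image_eq_zero_of_notMem_tsupport this, Complex.ofReal_zero]
  have hder : ∀ x, fderiv ℝ (fun x => w x * (η x : ℂ)) x v
      = w x * (fderiv ℝ η x v : ℂ) + fderiv ℝ w x v * (η x : ℂ) := by
    intro x
    have e1 := (hw1.differentiable one_ne_zero x).hasFDerivAt
    have e2 := Complex.ofRealCLM.hasFDerivAt.comp x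
      (hη.differentiable (by simp) x).hasFDerivAt
    have := (e1.mul e2).fderiv
    rw [show (fun x => w x * (η x : ℂ)) = w * (Complex.ofRealCLM ∘ η) from rfl, this]
    simp [mul_comm]
  have hint1 : Integrable (fun x => w x * (fderiv ℝ η x v : ℂ)) diskVol := by
    refine IntegrableOn.mono_set (t := Metric.closedBall 0 1) ?_ Metric.ball_subset_closedBall
    refine ContinuousOn.integrableOn_compact (isCompact_closedBall _ _) (Continuous.continuousOn ?_)
    exact hw1.continuous.mul (Complex.continuous_ofReal.comp
      ((hη.continuous_fderiv (by simp)).clm_apply continuous_const))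
  have hint2 : Integrable (fun x => fderiv ℝ w x v * (η x : ℂ)) diskVol := by
    refine IntegrableOn.mono_set (t := Metric.closedBall 0 1) ?_ Metric.ball_subset_closedBall
    refine ContinuousOn.integrableOn_compact (isCompact_closedBall _ _) (Continuous.continuousOn ?_)
    exact ((hw1.continuous_fderiv one_ne_zero).clm_apply continuous_const).mul hη1.continuous
  rw [← add_eq_zero_iff_eq_neg, ← integral_add hint1 hint2]
  simp only [← hder]
  rcases hv with rfl | hv
  · have := integral_divergence_disk hY (contDiff_const (c := (0 : ℂ)))
    simpa only [hb, fderiv_fun_const, Pi.zero_apply, zero_apply, add_zero,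
      zero_add, mul_zero, integral_zero] using this
  · rw [Set.mem_singleton_iff] at hv
    subst hv
    have := integral_divergence_disk (contDiff_const (c := (0 : ℂ))) hY
    simpa only [hb, fderiv_fun_const, Pi.zero_apply, zero_apply, add_zero,
      zero_add, mul_zero, integral_zero] using this

/-! ### Coercive operators and first variation of boundary energies -/

section Abstract

variable {X : Type*} [NormedAddCommGroup X] [InnerProductSpace ℂ X] [CompleteSpace X]

/-- The Lax–Milgram theorem for a bounded operator that is coercive on a closed subspace `V`: every
`E` can be corrected by an element of `V` so that its image under `T` is orthogonal to `V`. -/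
theorem exists_orthogonal_correction (V : Submodule ℂ X) (hV : IsClosed (V : Set X))
    (T : X →L[ℂ] X) {c : ℝ} (hc : 0 < c)
    (hT : ∀ w ∈ V, c * ‖w‖ ^ 2 ≤ (inner ℂ w (T w)).re) (E : X) :
    ∃ v ∈ V, ∀ w ∈ V, inner ℂ w (T (E - v)) = 0 := by
  have : CompleteSpace V := hV.completeSpace_coe
  have hinner : ∀ (w : V) (y : X), inner ℂ w (V.orthogonalProjectionOnto y) = inner ℂ (w : X) y :=
    fun w y => Submodule.inner_orthogonalProjectionOnto_eq_of_mem_left w y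
  set S : V →L[ℂ] V := V.orthogonalProjectionOnto ∘L T ∘L V.subtypeL with hS
  have hSi : ∀ w v : V, inner ℂ w (S v) = inner ℂ (w : X) (T v) := fun w v => hinner w _
  have hbelow : ∀ w : V, c * ‖w‖ ≤ ‖S w‖ := by
    intro w
    rcases (norm_nonneg w).eq_or_lt with h | h
    · rw [← h]; simp
    · refine le_of_mul_le_mul_right ?_ h
      calc c * ‖w‖ * ‖w‖ = c * ‖(w : X)‖ ^ 2 := by rw [Submodule.coe_norm]; ring
        _ ≤ (inner ℂ (w : X) (T w)).re := hT w w.2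
        _ = (inner ℂ w (S w)).re := by rw [hSi]
        _ ≤ ‖inner ℂ w (S w)‖ := Complex.re_le_norm _
        _ ≤ ‖w‖ * ‖S w‖ := norm_inner_le_norm _ _
        _ = ‖S w‖ * ‖w‖ := mul_comm _ _
  have hanti : AntilipschitzWith (Real.toNNReal c⁻¹) S := by
    refine ContinuousLinearMap.antilipschitz_of_bound S fun w => ?_
    rw [Real.coe_toNNReal _ (inv_nonneg.2 hc.le), ← div_eq_inv_mul, le_div_iff₀ hc, mul_comm]
    exact hbelow w
  have hclosed : IsClosed (S.range : Set V) := hanti.isClosed_range S.uniformContinuous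
  have htop : S.range = ⊤ := by
    have := hclosed.completeSpace_coe
    rw [← S.range.orthogonal_orthogonal, Submodule.eq_top_iff']
    intro v w hw
    obtain rfl : w = 0 := by
      have h0 : inner ℂ w (S w) = 0 := by
        rw [← inner_conj_symm, hw (S w) ⟨w, rfl⟩, map_zero]
      have h1 := hT w w.2
      rw [← hSi, h0, Complex.zero_re] at h1
      have h2 : ‖(w : X)‖ ^ 2 ≤ 0 := by
        by_contra hneg
        push Not at hneg
        nlinarith
      have h3 : ‖(w : X)‖ = 0 := by nlinarith [norm_nonneg (w : X)]
      exact Subtype.ext (norm_eq_zero.1 h3)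
    exact inner_zero_left _
  obtain ⟨v, hv⟩ : V.orthogonalProjectionOnto (T E) ∈ S.range := by rw [htop]; trivial
  refine ⟨v, v.2, fun w hw => ?_⟩
  have h1 : inner ℂ (⟨w, hw⟩ : V) (S v) = inner ℂ w (T v) := hSi ⟨w, hw⟩ v
  have h2 : inner ℂ (⟨w, hw⟩ : V) (V.orthogonalProjectionOnto (T E)) = inner ℂ w (T E) := hinner ⟨w, hw⟩ _
  rw [map_sub, inner_sub_right, ← h1, ← h2, sub_eq_zero]
  exact congrArg _ hv.symm

/-- Coercivity survives small perturbations. -/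
lemma coercive_add_smul (V : Submodule ℂ X) (M H : X →L[ℂ] X) {c : ℝ}
    (hM : ∀ w ∈ V, c * ‖w‖ ^ 2 ≤ (inner ℂ w (M w)).re) {ε : ℝ} (hε : |ε| * ‖H‖ ≤ c / 2) :
    ∀ w ∈ V, c / 2 * ‖w‖ ^ 2 ≤ (inner ℂ w ((M + (ε : ℂ) • H) w)).re := by
  intro w hw
  have h1 := hM w hw
  have h2 : ‖inner ℂ w (((ε : ℂ) • H) w)‖ ≤ c / 2 * ‖w‖ ^ 2 := by
    calc _ ≤ ‖w‖ * ‖((ε : ℂ) • H) w‖ := norm_inner_le_norm _ _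
      _ ≤ ‖w‖ * (‖(ε : ℂ) • H‖ * ‖w‖) := by gcongr; exact ContinuousLinearMap.le_opNorm _ _
      _ = |ε| * ‖H‖ * ‖w‖ ^ 2 := by rw [norm_smul, Complex.norm_real, Real.norm_eq_abs]; ring
      _ ≤ _ := by gcongr
  have h3 : -‖inner ℂ w (((ε : ℂ) • H) w)‖ ≤ (inner ℂ w (((ε : ℂ) • H) w)).re :=
    (abs_le.1 (Complex.abs_re_le_norm _)).1
  rw [add_apply, inner_add_right, Complex.add_re]
  linarith

lemma eventually_abs_mul_le (a : ℝ) {b : ℝ} (hb : 0 < b) : ∀ᶠ ε : ℝ in 𝓝 0, |ε| * a ≤ b := by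
  have : Tendsto (fun ε : ℝ => |ε| * a) (𝓝 0) (𝓝 0) := by
    have : Continuous fun ε : ℝ => |ε| * a := by fun_prop
    simpa using this.tendsto 0
  exact (this.eventually_lt_const hb).mono fun _ h => h.le

/-- First variation of a boundary energy. If `M` is coercive on `V`, the solutions `u ε` of the
perturbed equations with operator `M + ε H` depend continuously on `ε`. By the symmetry of `M`, the
energy `⟪E, (M + ε H) u ε⟫` differs from its value at `ε = 0` by `ε ⟪U, H (u ε)⟫`, where `U` solves
the unperturbed equation with the boundary values of `E`. -/
theorem hasDerivAt_energy (V : Submodule ℂ X) (M H : X →L[ℂ] X)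
    (hMs : ∀ x y, inner ℂ (M x) y = inner ℂ x (M y)) {c : ℝ} (hc : 0 < c)
    (hM : ∀ w ∈ V, c * ‖w‖ ^ 2 ≤ (inner ℂ w (M w)).re)
    {U u₀ E : X} (hU : ∀ w ∈ V, inner ℂ w (M U) = 0) (hu₀ : ∀ w ∈ V, inner ℂ w (M u₀) = 0)
    (hE : E - U ∈ V) {u : ℝ → X} (hu : ∀ᶠ ε : ℝ in 𝓝 0, u ε - u₀ ∈ V ∧
      ∀ w ∈ V, inner ℂ w ((M + (ε : ℂ) • H) (u ε)) = 0) :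
    HasDerivAt (fun ε : ℝ => inner ℂ E ((M + (ε : ℂ) • H) (u ε))) (inner ℂ U (H u₀)) 0 := by
  -- the energy may be computed with `U` in place of `E`, and then expanded
  have hform : ∀ᶠ ε : ℝ in 𝓝 0, inner ℂ E ((M + (ε : ℂ) • H) (u ε))
      = inner ℂ U (M u₀) + (ε : ℂ) * inner ℂ U (H (u ε)) := by
    filter_upwards [hu] with ε hε
    have e1 : inner ℂ E ((M + (ε : ℂ) • H) (u ε)) = inner ℂ U ((M + (ε : ℂ) • H) (u ε)) := by
      rw [← sub_eq_zero, ← inner_sub_left]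
      exact hε.2 _ hE
    have e2 : inner ℂ U (M (u ε)) = inner ℂ U (M u₀) := by
      rw [← sub_eq_zero, ← inner_sub_right, ← map_sub, ← hMs, ← inner_conj_symm, hU _ hε.1,
        map_zero]
    rw [e1, add_apply, inner_add_right, e2, smul_apply,
      inner_smul_right]
  have hbound : ∀ᶠ ε : ℝ in 𝓝 0, ‖u ε - u₀‖ ≤ |ε| * (2 / c * (‖H‖ * ‖u₀‖)) := by
    filter_upwards [hu, eventually_abs_mul_le ‖H‖ (half_pos hc)] with ε hε hsmall
    have h1 := coercive_add_smul V M H hM hsmall _ hε.1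
    have e1 : inner ℂ (u ε - u₀) ((M + (ε : ℂ) • H) (u ε - u₀))
        = -((ε : ℂ) * inner ℂ (u ε - u₀) (H u₀)) := by
      rw [map_sub, inner_sub_right, hε.2 _ hε.1, add_apply, inner_add_right,
        hu₀ _ hε.1, smul_apply, inner_smul_right]
      ring
    rw [e1] at h1
    have h2 : (-((ε : ℂ) * inner ℂ (u ε - u₀) (H u₀))).re ≤ |ε| * (‖u ε - u₀‖ * (‖H‖ * ‖u₀‖)) := by
      refine (Complex.re_le_norm _).trans ?_
      rw [norm_neg, norm_mul, Complex.norm_real, Real.norm_eq_abs]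
      gcongr
      exact (norm_inner_le_norm _ _).trans (by gcongr; exact H.le_opNorm _)
    have h3 := h1.trans h2
    rcases (norm_nonneg (u ε - u₀)).eq_or_lt with h | h
    · rw [← h]; positivity
    · have h4 : c / 2 * ‖u ε - u₀‖ ≤ |ε| * (‖H‖ * ‖u₀‖) := by
        refine le_of_mul_le_mul_right ?_ h
        nlinarith
      calc ‖u ε - u₀‖ = 2 / c * (c / 2 * ‖u ε - u₀‖) := by field_simp
        _ ≤ 2 / c * (|ε| * (‖H‖ * ‖u₀‖)) := by gcongr
        _ = _ := by ring
  have hlim : Tendsto u (𝓝 0) (𝓝 u₀) := by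
    rw [tendsto_iff_norm_sub_tendsto_zero]
    refine squeeze_zero' (Eventually.of_forall fun _ => norm_nonneg _) hbound ?_
    have : Continuous fun ε : ℝ => |ε| * (2 / c * (‖H‖ * ‖u₀‖)) := by fun_prop
    simpa using this.tendsto 0
  have hlim2 : Tendsto (fun ε => inner ℂ U (H (u ε))) (𝓝 0) (𝓝 (inner ℂ U (H u₀))) :=
    ((continuous_const.inner H.continuous).tendsto u₀).comp hlim
  have h0 := hform.self_of_nhds
  rw [hasDerivAt_iff_tendsto_slope]
  refine (hlim2.mono_left nhdsWithin_le_nhds).congr' ?_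
  filter_upwards [self_mem_nhdsWithin, hform.filter_mono nhdsWithin_le_nhds] with ε hε hf
  rw [slope_def_module, hf, h0]
  simp only [Set.mem_compl_iff, Set.mem_singleton_iff] at hε
  have hε' : (ε : ℂ) ≠ 0 := by exact_mod_cast hε
  simp [Complex.real_smul, hε']

end Abstract

/-! ### Traces and the Hilbert space of jets -/

/-- `L²` of the disk. -/
abbrev L2Disk : Type := Lp ℂ 2 diskVol

/-- `L²` of the circle. -/
abbrev L2Circle : Type := Lp ℂ 2 arcLength

/-- The Hilbert space `L²(𝔻)³`, in which `u ∈ H¹` is represented by `(u, ∂₁u, ∂₂u)`. -/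
abbrev JetSpace : Type := PiLp 2 (fun _ : Fin 3 => L2Disk)

/-- The element `(u, ∂₁u, ∂₂u)` of `L²(𝔻)³`. -/
def H1.jet (u : H1) : JetSpace :=
  WithLp.toLp 2 ![u.val_mem.toLp, u.d1_mem.toLp, u.d2_mem.toLp]

lemma exists_bound_on_disk {w : ℂ → ℂ} (hw : Continuous w) : ∃ C, ∀ x ∈ disk, ‖w x‖ ≤ C := by
  obtain ⟨C, hC⟩ := (isCompact_closedBall (0 : ℂ) 1).exists_bound_of_continuousOn hw.continuousOn
  exact ⟨C, fun x hx => hC x (Metric.ball_subset_closedBall hx)⟩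

lemma memLp_diskVol {w : ℂ → ℂ} (hw : Continuous w) (p : ℝ≥0∞) : MemLp w p diskVol := by
  obtain ⟨C, hC⟩ := exists_bound_on_disk hw
  exact MemLp.of_bound hw.aestronglyMeasurable C (ae_mem_disk.mono hC)

lemma memLp_arcLength {w : ℂ → ℂ} (hw : Continuous w) (p : ℝ≥0∞) :
    MemLp (fun θ : ℝ => w (Circle.exp θ)) p arcLength := by
  have hc : Continuous fun θ : ℝ => w (Circle.exp θ) :=
    hw.comp (continuous_subtype_val.comp Circle.exp.continuous)
  obtain ⟨C, hC⟩ := (isCompact_closedBall (0 : ℂ) 1).exists_bound_of_continuousOn hw.continuousOn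
  refine MemLp.of_bound hc.aestronglyMeasurable C (Eventually.of_forall fun θ => hC _ ?_)
  simp

lemma continuous_fderiv_dir {w : ℂ → ℂ} (hw : ContDiff ℝ ∞ w) (v : ℂ) :
    Continuous fun x => fderiv ℝ w x v :=
  (hw.continuous_fderiv (by simp)).clm_apply continuous_const

/-- A smooth function on the plane as an element of `H¹` of the disk. -/
def smoothH1 (w : ℂ → ℂ) (hw : ContDiff ℝ ∞ w) : H1 where
  val := w
  d1 := fun x => fderiv ℝ w x 1
  d2 := fun x => fderiv ℝ w x Complex.I
  val_mem := memLp_diskVol hw.continuous 2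
  d1_mem := memLp_diskVol (continuous_fderiv_dir hw 1) 2
  d2_mem := memLp_diskVol (continuous_fderiv_dir hw Complex.I) 2
  weak1 := isWeakDeriv_fderiv hw (by simp)
  weak2 := isWeakDeriv_fderiv hw (by simp)

/-- The boundary values of a smooth function as an element of `L²` of the circle. -/
def smoothTrace (w : ℂ → ℂ) (hw : ContDiff ℝ ∞ w) : L2Circle :=
  (memLp_arcLength hw.continuous 2).toLp

lemma jet_ext {x y : JetSpace} (h : ∀ i, x i = y i) : x = y := PiLp.ext h

lemma fderiv_dir_add {w z : ℂ → ℂ} (hw : ContDiff ℝ ∞ w) (hz : ContDiff ℝ ∞ z) (v : ℂ) :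
    (fun x => fderiv ℝ (w + z) x v) = fun x => fderiv ℝ w x v + fderiv ℝ z x v := by
  funext x
  rw [fderiv_add (hw.differentiable (by simp) x) (hz.differentiable (by simp) x)]
  rfl

lemma fderiv_dir_smul {w : ℂ → ℂ} (hw : ContDiff ℝ ∞ w) (c v : ℂ) :
    (fun x => fderiv ℝ (c • w) x v) = fun x => c * fderiv ℝ w x v := by
  funext x
  rw [fderiv_const_smul (hw.differentiable (by simp) x)]
  rfl

lemma jet_eq_add {u v w : H1} (h0 : ∀ x, u.val x = v.val x + w.val x)
    (h1 : ∀ x, u.d1 x = v.d1 x + w.d1 x) (h2 : ∀ x, u.d2 x = v.d2 x + w.d2 x) :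
    u.jet = v.jet + w.jet := by
  refine jet_ext fun i => ?_
  fin_cases i
  · exact (MemLp.toLp_congr u.val_mem (v.val_mem.add w.val_mem) (Eventually.of_forall h0)).trans
      (MemLp.toLp_add v.val_mem w.val_mem)
  · exact (MemLp.toLp_congr u.d1_mem (v.d1_mem.add w.d1_mem) (Eventually.of_forall h1)).trans
      (MemLp.toLp_add v.d1_mem w.d1_mem)
  · exact (MemLp.toLp_congr u.d2_mem (v.d2_mem.add w.d2_mem) (Eventually.of_forall h2)).trans
      (MemLp.toLp_add v.d2_mem w.d2_mem)

lemma jet_eq_smul {u v : H1} (c : ℂ) (h0 : ∀ x, u.val x = c * v.val x)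
    (h1 : ∀ x, u.d1 x = c * v.d1 x) (h2 : ∀ x, u.d2 x = c * v.d2 x) :
    u.jet = c • v.jet := by
  refine jet_ext fun i => ?_
  fin_cases i
  · exact (MemLp.toLp_congr u.val_mem (v.val_mem.const_smul c) (Eventually.of_forall h0)).trans
      (MemLp.toLp_const_smul c v.val_mem)
  · exact (MemLp.toLp_congr u.d1_mem (v.d1_mem.const_smul c) (Eventually.of_forall h1)).trans
      (MemLp.toLp_const_smul c v.d1_mem)
  · exact (MemLp.toLp_congr u.d2_mem (v.d2_mem.const_smul c) (Eventually.of_forall h2)).trans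
      (MemLp.toLp_const_smul c v.d2_mem)

lemma smooth_add {w z : ℂ → ℂ} (hw : ContDiff ℝ ∞ w) (hz : ContDiff ℝ ∞ z) :
    ((smoothH1 (w + z) (hw.add hz)).jet, smoothTrace (w + z) (hw.add hz))
      = ((smoothH1 w hw).jet, smoothTrace w hw) + ((smoothH1 z hz).jet, smoothTrace z hz) :=
  Prod.ext (jet_eq_add (fun _ => rfl) (congrFun (fderiv_dir_add hw hz 1))
    (congrFun (fderiv_dir_add hw hz Complex.I)))
    (MemLp.toLp_add (memLp_arcLength hw.continuous 2) (memLp_arcLength hz.continuous 2))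

lemma smooth_smul {w : ℂ → ℂ} (hw : ContDiff ℝ ∞ w) (c : ℂ) :
    ((smoothH1 (c • w) (hw.const_smul c)).jet, smoothTrace (c • w) (hw.const_smul c))
      = c • ((smoothH1 w hw).jet, smoothTrace w hw) :=
  Prod.ext (jet_eq_smul c (fun _ => rfl) (congrFun (fderiv_dir_smul hw c 1))
    (congrFun (fderiv_dir_smul hw c Complex.I)))
    (MemLp.toLp_const_smul c (memLp_arcLength hw.continuous 2))

/-- The graph of the trace operator on functions smooth up to the boundary. -/
def smoothGraph : Submodule ℂ (JetSpace × L2Circle) where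
  carrier := {y | ∃ (w : ℂ → ℂ) (hw : ContDiff ℝ ∞ w), y = ((smoothH1 w hw).jet, smoothTrace w hw)}
  zero_mem' :=
    have h0 : ContDiff ℝ ∞ (0 : ℂ → ℂ) := contDiff_const
    ⟨_, _, ((smooth_smul h0 0).trans (zero_smul ℂ _)).symm⟩
  add_mem' := by
    rintro _ _ ⟨w, hw, rfl⟩ ⟨z, hz, rfl⟩
    exact ⟨w + z, hw.add hz, (smooth_add hw hz).symm⟩
  smul_mem' := by
    rintro c _ ⟨w, hw, rfl⟩
    exact ⟨c • w, hw.const_smul c, (smooth_smul hw c).symm⟩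

lemma mem_smoothGraph {y : JetSpace × L2Circle} : y ∈ smoothGraph ↔
    ∃ (w : ℂ → ℂ) (hw : ContDiff ℝ ∞ w), y = ((smoothH1 w hw).jet, smoothTrace w hw) := Iff.rfl

/-- The subspace of `L²(𝔻)³` that corresponds to `H¹₀`. -/
def traceZero : Submodule ℂ JetSpace :=
  smoothGraph.topologicalClosure.comap (LinearMap.inl ℂ JetSpace L2Circle)

lemma mem_traceZero {x : JetSpace} :
    x ∈ traceZero ↔ (x, (0 : L2Circle)) ∈ smoothGraph.topologicalClosure := Iff.rfl

lemma isClosed_traceZero : IsClosed (traceZero : Set JetSpace) :=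
  smoothGraph.isClosed_topologicalClosure.preimage
    (continuous_id.prodMk continuous_const : Continuous fun x : JetSpace => (x, (0 : L2Circle)))

/-- A closed condition that holds for smooth functions holds on the closure of `smoothGraph`. -/
lemma closure_induction_smooth {S : Set (JetSpace × L2Circle)} (hS : IsClosed S)
    (h : ∀ (w : ℂ → ℂ) (hw : ContDiff ℝ ∞ w), ((smoothH1 w hw).jet, smoothTrace w hw) ∈ S)
    {y : JetSpace × L2Circle} (hy : y ∈ smoothGraph.topologicalClosure) : y ∈ S := by
  refine closure_minimal (s := (smoothGraph : Set (JetSpace × L2Circle))) ?_ hS hy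
  intro y hy
  obtain ⟨w, hw, rfl⟩ := mem_smoothGraph.1 hy
  exact h w hw

lemma tendsto_jet {u : ℕ → H1} {v : H1} :
    Tendsto (fun n => (u n).jet) atTop (𝓝 v.jet) ↔
      Tendsto (fun n => eLpNorm (fun x => (u n).val x - v.val x) 2 diskVol) atTop (𝓝 0) ∧
      Tendsto (fun n => eLpNorm (fun x => (u n).d1 x - v.d1 x) 2 diskVol) atTop (𝓝 0) ∧
      Tendsto (fun n => eLpNorm (fun x => (u n).d2 x - v.d2 x) 2 diskVol) atTop (𝓝 0) := by
  have h0 := Lp.tendsto_Lp_iff_tendsto_eLpNorm'' (fi := atTop) (fun n => (u n).val)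
    (fun n => (u n).val_mem) v.val v.val_mem
  have h1 := Lp.tendsto_Lp_iff_tendsto_eLpNorm'' (fi := atTop) (fun n => (u n).d1)
    (fun n => (u n).d1_mem) v.d1 v.d1_mem
  have h2 := Lp.tendsto_Lp_iff_tendsto_eLpNorm'' (fi := atTop) (fun n => (u n).d2)
    (fun n => (u n).d2_mem) v.d2 v.d2_mem
  refine Iff.trans ⟨fun h => ?_, fun h => ?_⟩ (and_congr h0 (and_congr h1 h2))
  · have h' := tendsto_pi_nhds.1 (((PiLp.continuous_ofLp 2 (fun _ : Fin 3 => L2Disk)).tendsto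
      v.jet).comp h)
    exact ⟨h' 0, h' 1, h' 2⟩
  · refine ((PiLp.continuous_toLp 2 (fun _ : Fin 3 => L2Disk)).tendsto _).comp
      (tendsto_pi_nhds.2 fun i => ?_)
    fin_cases i
    · exact h.1
    · exact h.2.1
    · exact h.2.2

/-- The trace relation is the closure of its restriction to smooth functions. -/
theorem hasTrace_iff {u : H1} {f : Circle → ℂ} :
    HasTrace u f ↔ ∃ hf : MemLp (fun θ : ℝ => f (Circle.exp θ)) 2 arcLength,
      (u.jet, hf.toLp) ∈ smoothGraph.topologicalClosure := by
  constructor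
  · rintro ⟨hf, w, hw, h0, h1, h2, h3⟩
    refine ⟨hf, ?_⟩
    have hj : Tendsto (fun n => (smoothH1 (w n) (hw n)).jet) atTop (𝓝 u.jet) :=
      tendsto_jet.2 ⟨h0, h1, h2⟩
    have ht : Tendsto (fun n => smoothTrace (w n) (hw n)) atTop (𝓝 hf.toLp) :=
      (Lp.tendsto_Lp_iff_tendsto_eLpNorm'' (fi := atTop)
        (fun n (θ : ℝ) => w n (Circle.exp θ)) (fun n => memLp_arcLength (hw n).continuous 2)
        _ hf).2 h3
    exact mem_closure_of_tendsto (hj.prodMk_nhds ht) 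
      (Eventually.of_forall fun n => mem_smoothGraph.2 ⟨w n, hw n, rfl⟩)
  · rintro ⟨hf, h⟩
    obtain ⟨y, hy, hlim⟩ := mem_closure_iff_seq_limit.1 h
    choose w hw hyw using fun n => mem_smoothGraph.1 (hy n)
    rw [Prod.tendsto_iff] at hlim
    simp only [hyw] at hlim
    obtain ⟨h0, h1, h2⟩ := tendsto_jet.1 hlim.1
    exact ⟨hf, w, hw, h0, h1, h2, (Lp.tendsto_Lp_iff_tendsto_eLpNorm'' (fi := atTop)
        (fun n (θ : ℝ) => w n (Circle.exp θ)) (fun n => memLp_arcLength (hw n).continuous 2)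
        _ hf).1 hlim.2⟩

lemma memH10_iff {u : H1} : MemH10 u ↔ u.jet ∈ traceZero := by
  rw [MemH10, hasTrace_iff, mem_traceZero]
  have h0 : ∀ hf : MemLp (fun θ : ℝ => (0 : Circle → ℂ) (Circle.exp θ)) 2 arcLength,
      hf.toLp = 0 := fun hf => MemLp.toLp_zero hf
  constructor
  · rintro ⟨hf, h⟩
    rwa [h0] at h
  · intro h
    refine ⟨MemLp.zero, ?_⟩
    rwa [h0]

/-- Functions in `H¹` with the same trace differ by an element of `H¹₀`. -/
lemma jet_sub_mem_traceZero {u v : H1} {f : Circle → ℂ} (hu : HasTrace u f) (hv : HasTrace v f) :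
    u.jet - v.jet ∈ traceZero := by
  obtain ⟨hf, h1⟩ := hasTrace_iff.1 hu
  obtain ⟨_, h2⟩ := hasTrace_iff.1 hv
  have := smoothGraph.topologicalClosure.sub_mem h1 h2
  rwa [Prod.mk_sub_mk, sub_self] at this

lemma hasTrace_smooth {w : ℂ → ℂ} (hw : ContDiff ℝ ∞ w) {f : Circle → ℂ}
    (hf : ∀ z : Circle, w z = f z) : HasTrace (smoothH1 w hw) f := by
  have hf' : f = fun z : Circle => w z := funext fun z => (hf z).symm
  subst hf'
  exact hasTrace_iff.2 ⟨memLp_arcLength hw.continuous 2,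
    subset_closure (mem_smoothGraph.2 ⟨w, hw, rfl⟩)⟩

/-- The bilinear pairing with a fixed element of `L²` is continuous. -/
lemma continuous_integral_mul (g : L2Disk) :
    Continuous fun f : L2Disk => ∫ x, f x * g x ∂diskVol := by
  have : (fun f : L2Disk => ∫ x, f x * g x ∂diskVol)
      = fun f => (ContinuousLinearMap.mul ℂ ℂ).lpPairing diskVol 2 2 f g := by
    funext f
    rw [ContinuousLinearMap.lpPairing_eq_integral]
    rfl
  rw [this]
  exact ((ContinuousLinearMap.mul ℂ ℂ).lpPairing diskVol 2 2).continuous.clm_apply continuous_const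

lemma continuous_jet_coord (i : Fin 3) :
    Continuous fun y : JetSpace × L2Circle => y.1 i :=
  (PiLp.proj 2 (𝕜 := ℂ) (fun _ : Fin 3 => L2Disk) i).continuous.comp continuous_fst

/-- Weak differentiability is preserved under limits in `L²`. -/
lemma isWeakDeriv_of_mem_closure {y : JetSpace × L2Circle}
    (hy : y ∈ smoothGraph.topologicalClosure) {v : ℂ} {i : Fin 3}
    (hi : ∀ w hw, IsWeakDeriv v w ((smoothH1 w hw).jet i)) : IsWeakDeriv v (y.1 0) (y.1 i) := by
  intro η hη hη' hsupp
  have hd : Continuous fun x => (fderiv ℝ η x v : ℂ) := Complex.continuous_ofReal.comp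
    ((hη.continuous_fderiv (by simp)).clm_apply continuous_const)
  have hc : Continuous fun x => (η x : ℂ) := Complex.continuous_ofReal.comp hη.continuous
  have hd2 := memLp_diskVol hd 2
  have hc2 := memLp_diskVol hc 2
  have e1 : ∀ f : L2Disk, ∫ x, f x * (fderiv ℝ η x v : ℂ) ∂diskVol
      = ∫ x, f x * (hd2.toLp _ : L2Disk) x ∂diskVol := fun f =>
    integral_congr_ae (by filter_upwards [hd2.coeFn_toLp] with x hx; rw [hx])
  have e2 : ∀ f : L2Disk, ∫ x, f x * (η x : ℂ) ∂diskVol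
      = ∫ x, f x * (hc2.toLp _ : L2Disk) x ∂diskVol := fun f =>
    integral_congr_ae (by filter_upwards [hc2.coeFn_toLp] with x hx; rw [hx])
  refine closure_induction_smooth (S := {y : JetSpace × L2Circle |
    ∫ x, y.1 0 x * (fderiv ℝ η x v : ℂ) ∂diskVol = - ∫ x, y.1 i x * (η x : ℂ) ∂diskVol})
    ?_ ?_ hy
  · simp only [e1, e2]
    exact isClosed_eq ((continuous_integral_mul _).comp (continuous_jet_coord 0))
      ((continuous_integral_mul _).comp (continuous_jet_coord i)).neg
  · intro w hw
    have := hi w hw η hη hη' hsupp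
    have e3 : ∫ x, (smoothH1 w hw).jet 0 x * (fderiv ℝ η x v : ℂ) ∂diskVol
        = ∫ x, w x * (fderiv ℝ η x v : ℂ) ∂diskVol :=
      integral_congr_ae (by
        filter_upwards [(smoothH1 w hw).val_mem.coeFn_toLp] with x hx
        exact congrArg (· * _) hx)
    exact e3.trans this

lemma IsWeakDeriv.congr {v : ℂ} {u g g' : ℂ → ℂ} (h : IsWeakDeriv v u g) (hg : g =ᵐ[diskVol] g') :
    IsWeakDeriv v u g' := by
  intro η h1 h2 h3
  rw [h η h1 h2 h3]
  congr 1
  exact integral_congr_ae (by filter_upwards [hg] with x hx; rw [hx])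

/-- Every limit of smooth functions in `L²(𝔻)³` represents an element of `H¹`. -/
lemma exists_jet_eq {y : JetSpace × L2Circle} (hy : y ∈ smoothGraph.topologicalClosure) :
    ∃ u : H1, u.jet = y.1 := by
  refine ⟨⟨y.1 0, y.1 1, y.1 2, Lp.memLp _, Lp.memLp _, Lp.memLp _,
    isWeakDeriv_of_mem_closure hy fun w hw => ?_,
    isWeakDeriv_of_mem_closure hy fun w hw => ?_⟩, jet_ext fun i => ?_⟩
  · exact (smoothH1 w hw).weak1.congr (smoothH1 w hw).d1_mem.coeFn_toLp.symm
  · exact (smoothH1 w hw).weak2.congr (smoothH1 w hw).d2_mem.coeFn_toLp.symm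
  · fin_cases i <;> exact Lp.toLp_coeFn _ (Lp.memLp _)

/-- The complex conjugate of an element of `H¹`. -/
def H1.conj (u : H1) : H1 where
  val := fun x => conj (u.val x)
  d1 := fun x => conj (u.d1 x)
  d2 := fun x => conj (u.d2 x)
  val_mem := u.val_mem.star
  d1_mem := u.d1_mem.star
  d2_mem := u.d2_mem.star
  weak1 := by
    intro η h1 h2 h3
    have := congrArg conj (u.weak1 η h1 h2 h3)
    rw [map_neg, ← integral_conj, ← integral_conj] at this
    simpa using this
  weak2 := by
    intro η h1 h2 h3
    have := congrArg conj (u.weak2 η h1 h2 h3)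
    rw [map_neg, ← integral_conj, ← integral_conj] at this
    simpa using this

lemma H1.conj_jet_conj (u : H1) : u.conj.conj.jet = u.jet :=
  (jet_eq_smul 1 (fun x => by simp [H1.conj]) (fun x => by simp [H1.conj])
    (fun x => by simp [H1.conj])).trans (one_smul ℂ _)

lemma eLpNorm_conj_sub {α : Type*} [MeasurableSpace α] (f g : α → ℂ) (μ : Measure α) :
    eLpNorm (fun x => conj (f x) - conj (g x)) 2 μ = eLpNorm (fun x => f x - g x) 2 μ := by
  refine eLpNorm_congr_norm_ae (Eventually.of_forall fun x => ?_)
  rw [← map_sub, RCLike.norm_conj]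

lemma contDiff_conj {w : ℂ → ℂ} (hw : ContDiff ℝ ∞ w) : ContDiff ℝ ∞ fun x => conj (w x) :=
  Complex.conjCLE.contDiff.comp hw

lemma fderiv_conj {w : ℂ → ℂ} (hw : ContDiff ℝ ∞ w) (x v : ℂ) :
    fderiv ℝ (fun x => conj (w x)) x v = conj (fderiv ℝ w x v) := by
  have h := (Complex.conjCLE.toContinuousLinearMap.hasFDerivAt).comp x
    (hw.differentiable (by simp) x).hasFDerivAt
  rw [show (fun x => conj (w x)) = Complex.conjCLE.toContinuousLinearMap ∘ w from rfl, h.fderiv]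
  rfl

lemma HasTrace.conj {u : H1} {f : Circle → ℂ} (h : HasTrace u f) :
    HasTrace u.conj fun z => conj (f z) := by
  obtain ⟨hf, w, hw, h0, h1, h2, h3⟩ := h
  refine ⟨hf.star, fun n x => conj (w n x), fun n => contDiff_conj (hw n), ?_, ?_, ?_, ?_⟩
  · simpa only [H1.conj, eLpNorm_conj_sub] using h0
  · simpa only [H1.conj, fderiv_conj (hw _), eLpNorm_conj_sub] using h1
  · simpa only [H1.conj, fderiv_conj (hw _), eLpNorm_conj_sub] using h2
  · simpa only [eLpNorm_conj_sub] using h3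

lemma MemH10.conj {u : H1} (h : MemH10 u) : MemH10 u.conj := by
  have := HasTrace.conj h
  simpa [MemH10, Pi.zero_def] using this

/-! ### The energy form and the derivative of the Dirichlet-to-Neumann forms -/

/-- Multiplication by a bounded function on `L²` of the disk. -/
def mulOp (a : Lp ℂ ∞ diskVol) : L2Disk →L[ℂ] L2Disk :=
  (ContinuousLinearMap.mul ℂ ℂ).holderL diskVol ∞ 2 2 a

lemma mulOp_coe (a : Lp ℂ ∞ diskVol) (f : L2Disk) :
    mulOp a f =ᵐ[diskVol] fun x => a x * f x :=
  (ContinuousLinearMap.mul ℂ ℂ).coeFn_holder (r := 2) a f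

lemma mulOp_add_smul (a b : Lp ℂ ∞ diskVol) (c : ℂ) :
    mulOp (a + c • b) = mulOp a + c • mulOp b := by
  simp only [mulOp, map_add, map_smul]

/-- The operator `(u, u₁, u₂) ↦ (b u, a u₁, a u₂)` on `L²(𝔻)³`. -/
def formOp (a b : Lp ℂ ∞ diskVol) : JetSpace →L[ℂ] JetSpace :=
  (PiLp.continuousLinearEquiv 2 ℂ (fun _ : Fin 3 => L2Disk)).symm.toContinuousLinearMap ∘L
    ContinuousLinearMap.pi fun i => mulOp (![b, a, a] i) ∘L PiLp.proj 2 (fun _ : Fin 3 => L2Disk) i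

lemma formOp_apply (a b : Lp ℂ ∞ diskVol) (x : JetSpace) (i : Fin 3) :
    formOp a b x i = mulOp (![b, a, a] i) (x i) := rfl

lemma formOp_add_smul (a b a' b' : Lp ℂ ∞ diskVol) (c : ℂ) :
    formOp (a + c • a') (b + c • b') = formOp a b + c • formOp a' b' := by
  refine ContinuousLinearMap.ext fun x => jet_ext fun i => ?_
  have h : formOp (a + c • a') (b + c • b') x i
      = mulOp (![b, a, a] i + c • ![b', a', a'] i) (x i) := by
    rw [formOp_apply]
    fin_cases i <;> rfl
  rw [h, mulOp_add_smul]
  rfl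

lemma inner_formOp (a b : Lp ℂ ∞ diskVol) (x y : JetSpace) :
    inner ℂ x (formOp a b y) = inner ℂ (x 0) (mulOp b (y 0)) + inner ℂ (x 1) (mulOp a (y 1))
      + inner ℂ (x 2) (mulOp a (y 2)) := by
  rw [PiLp.inner_apply, Fin.sum_univ_three]
  rfl

/-- The class in `L^∞` of a bounded real function. -/
def linf (γ : ℂ → ℝ) (hγ : MemLp γ ∞ diskVol) : Lp ℂ ∞ diskVol :=
  MemLp.toLp (fun x => (γ x : ℂ)) hγ.ofReal

lemma linf_coe {γ : ℂ → ℝ} (hγ : MemLp γ ∞ diskVol) :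
    linf γ hγ =ᵐ[diskVol] fun x => (γ x : ℂ) := MemLp.coeFn_toLp _

lemma linf_add_smul {γ h : ℂ → ℝ} (hγ : MemLp γ ∞ diskVol) (hh : MemLp h ∞ diskVol) (ε : ℝ)
    (hs : MemLp (fun x => γ x + ε * h x) ∞ diskVol) :
    linf (fun x => γ x + ε * h x) hs = linf γ hγ + (ε : ℂ) • linf h hh := by
  refine Lp.ext ?_
  filter_upwards [linf_coe hs, linf_coe hγ, linf_coe hh, Lp.coeFn_add (linf γ hγ)
    ((ε : ℂ) • linf h hh), Lp.coeFn_smul (ε : ℂ) (linf h hh)] with x h1 h2 h3 h4 h5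
  rw [h1, h4, Pi.add_apply, h5, Pi.smul_apply, h2, h3]
  push_cast
  rfl

lemma memLp_add_mul {γ h : ℂ → ℝ} (hγ : MemLp γ ∞ diskVol) (hh : MemLp h ∞ diskVol) (ε : ℝ) :
    MemLp (fun x => γ x + ε * h x) ∞ diskVol := hγ.add (hh.const_mul ε)

lemma inner_mulOp_toLp {γ : ℂ → ℝ} (hγ : MemLp γ ∞ diskVol) {f g : ℂ → ℂ}
    (hf : MemLp f 2 diskVol) (hg : MemLp g 2 diskVol) :
    inner ℂ (hf.toLp f) (mulOp (linf γ hγ) (hg.toLp g))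
      = ∫ x, (γ x : ℂ) * (g x * conj (f x)) ∂diskVol := by
  rw [L2.inner_def]
  refine integral_congr_ae ?_
  filter_upwards [mulOp_coe (linf γ hγ) (hg.toLp g), linf_coe hγ, hf.coeFn_toLp, hg.coeFn_toLp]
    with x h1 h2 h3 h4
  rw [h1, h2, h3, h4, RCLike.inner_apply]
  ring

lemma integrable_mul_mul {γ : ℂ → ℝ} (hγ : MemLp γ ∞ diskVol) {f g : ℂ → ℂ}
    (hf : MemLp f 2 diskVol) (hg : MemLp g 2 diskVol) :
    Integrable (fun x => (γ x : ℂ) * (f x * g x)) diskVol := by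
  have h1 : Integrable (f * g) diskVol := hf.integrable_mul hg
  have h2 : MemLp (fun x => (γ x : ℂ)) ∞ diskVol := hγ.ofReal
  have h3 := MemLp.integrable_mul (p := ∞) (q := 1) h2 (memLp_one_iff_integrable.2 h1)
  exact h3

lemma inner_mulOp_symm {γ : ℂ → ℝ} (hγ : MemLp γ ∞ diskVol) (f g : L2Disk) :
    inner ℂ (mulOp (linf γ hγ) f) g = inner ℂ f (mulOp (linf γ hγ) g) := by
  rw [L2.inner_def, L2.inner_def]
  refine integral_congr_ae ?_
  filter_upwards [mulOp_coe (linf γ hγ) f, mulOp_coe (linf γ hγ) g, linf_coe hγ] with x h1 h2 h3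
  rw [h1, h2, h3, RCLike.inner_apply, RCLike.inner_apply, map_mul, Complex.conj_ofReal]
  ring

lemma inner_formOp_symm {γ q : ℂ → ℝ} (hγ : MemLp γ ∞ diskVol) (hq : MemLp q ∞ diskVol)
    (x y : JetSpace) :
    inner ℂ (formOp (linf γ hγ) (linf q hq) x) y
      = inner ℂ x (formOp (linf γ hγ) (linf q hq) y) := by
  rw [inner_formOp, PiLp.inner_apply, Fin.sum_univ_three]
  simp only [formOp_apply, ← inner_mulOp_symm]
  rfl

/-- The bilinear form `∫ (γ ∇u · ∇w + q u w)`. -/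
def energy (γ q : ℂ → ℝ) (u w : H1) : ℂ :=
  ∫ x, ((γ x : ℂ) * gradDot u w x + (q x : ℂ) * u.val x * w.val x) ∂diskVol

lemma energy_comm (γ q : ℂ → ℝ) (u w : H1) : energy γ q u w = energy γ q w u := by
  unfold energy gradDot
  congr 1
  funext x
  ring

/-- The energy form in terms of the Hilbert space `L²(𝔻)³`. -/
lemma energy_eq_inner {γ q : ℂ → ℝ} (hγ : MemLp γ ∞ diskVol) (hq : MemLp q ∞ diskVol) (u w : H1) :
    energy γ q u w = inner ℂ w.conj.jet (formOp (linf γ hγ) (linf q hq) u.jet) := by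
  rw [inner_formOp]
  have e0 := inner_mulOp_toLp hq w.conj.val_mem u.val_mem
  have e1 := inner_mulOp_toLp hγ w.conj.d1_mem u.d1_mem
  have e2 := inner_mulOp_toLp hγ w.conj.d2_mem u.d2_mem
  refine Eq.trans ?_ (congrArg₂ (· + ·) (congrArg₂ (· + ·) e0 e1) e2).symm
  simp only [H1.conj, Complex.conj_conj]
  have i1 : Integrable (fun x => (q x : ℂ) * (u.val x * w.val x) + γ x * (u.d1 x * w.d1 x))
      diskVol :=
    (integrable_mul_mul hq u.val_mem w.val_mem).add (integrable_mul_mul hγ u.d1_mem w.d1_mem)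
  rw [← integral_add (integrable_mul_mul hq u.val_mem w.val_mem)
    (integrable_mul_mul hγ u.d1_mem w.d1_mem), ← integral_add i1
    (integrable_mul_mul hγ u.d2_mem w.d2_mem)]
  unfold energy gradDot
  congr 1
  funext x
  ring

/-- Weak solutions of `-∇·(γ∇u) + q u = 0` in the disk with boundary values `g`. -/
def IsFormSol (γ q : ℂ → ℝ) (g : Circle → ℂ) (u : H1) : Prop :=
  HasTrace u g ∧ ∀ w : H1, MemH10 w → energy γ q u w = 0

lemma isCondSol_iff {γ : ℂ → ℝ} {g : Circle → ℂ} {u : H1} :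
    IsCondSol γ g u ↔ IsFormSol γ (fun _ => 0) g u := by
  simp [IsCondSol, IsFormSol, energy]

lemma isSchrodingerSol_iff {q : ℂ → ℝ} {g : Circle → ℂ} {u : H1} :
    IsSchrodingerSol q g u ↔ IsFormSol (fun _ => 1) q g u := by
  simp [IsSchrodingerSol, IsFormSol, energy]

lemma forall_energy_eq_zero_iff {γ q : ℂ → ℝ} (hγ : MemLp γ ∞ diskVol) (hq : MemLp q ∞ diskVol)
    (u : H1) : (∀ w : H1, MemH10 w → energy γ q u w = 0) ↔
      ∀ x ∈ traceZero, inner ℂ x (formOp (linf γ hγ) (linf q hq) u.jet) = 0 := by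
  constructor
  · intro h x hx
    obtain ⟨w, hw⟩ := exists_jet_eq (mem_traceZero.1 hx)
    have hw : w.jet = x := hw
    rw [← hw, ← w.conj_jet_conj, ← energy_eq_inner]
    exact h _ (MemH10.conj (memH10_iff.2 (hw ▸ hx)))
  · intro h w hw
    rw [energy_eq_inner hγ hq]
    exact h _ (memH10_iff.1 hw.conj)

lemma IsFormSol.conj {γ q : ℂ → ℝ} {g : Circle → ℂ} {u : H1} (h : IsFormSol γ q g u) :
    IsFormSol γ q (fun z => conj (g z)) u.conj := by
  refine ⟨h.1.conj, fun w hw => ?_⟩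
  have h1 := congrArg conj (h.2 w.conj hw.conj)
  rw [energy, ← integral_conj, map_zero] at h1
  rw [energy, ← h1]
  congr 1
  funext x
  simp [gradDot, H1.conj]

/-- Coercivity on `H¹₀` of the form `∫ (γ |∇u|² + q |u|²)`. -/
def IsCoerciveForm (γ q : ℂ → ℝ) (hγ : MemLp γ ∞ diskVol) (hq : MemLp q ∞ diskVol) : Prop :=
  ∃ c : ℝ, 0 < c ∧
    ∀ x ∈ traceZero, c * ‖x‖ ^ 2 ≤ (inner ℂ x (formOp (linf γ hγ) (linf q hq) x)).re

lemma jet_eq_iff {u v : H1} : u.jet = v.jet ↔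
    u.val =ᵐ[diskVol] v.val ∧ u.d1 =ᵐ[diskVol] v.d1 ∧ u.d2 =ᵐ[diskVol] v.d2 := by
  rw [← MemLp.toLp_eq_toLp_iff u.val_mem v.val_mem, ← MemLp.toLp_eq_toLp_iff u.d1_mem v.d1_mem,
    ← MemLp.toLp_eq_toLp_iff u.d2_mem v.d2_mem]
  constructor
  · intro h
    have h' : ∀ i, u.jet i = v.jet i := fun i => by rw [h]
    exact ⟨h' 0, h' 1, h' 2⟩
  · rintro ⟨h0, h1, h2⟩
    refine jet_ext fun i => ?_
    fin_cases i
    exacts [h0, h1, h2]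

section Coercive

variable {γ q : ℂ → ℝ} {hγ : MemLp γ ∞ diskVol} {hq : MemLp q ∞ diskVol}

/-- Coercivity gives uniqueness. -/
lemma IsCoerciveForm.jet_eq (hc : IsCoerciveForm γ q hγ hq) {g : Circle → ℂ} {u v : H1}
    (hu : IsFormSol γ q g u) (hv : IsFormSol γ q g v) : u.jet = v.jet := by
  obtain ⟨c, hc0, hc⟩ := hc
  have hmem := jet_sub_mem_traceZero hu.1 hv.1
  have h1 := hc _ hmem
  rw [map_sub, inner_sub_right, (forall_energy_eq_zero_iff hγ hq u).1 hu.2 _ hmem,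
    (forall_energy_eq_zero_iff hγ hq v).1 hv.2 _ hmem, sub_zero, Complex.zero_re] at h1
  have h2 : ‖u.jet - v.jet‖ ^ 2 ≤ 0 := by
    by_contra hneg
    push Not at hneg
    nlinarith
  have h3 : ‖u.jet - v.jet‖ = 0 := by nlinarith [norm_nonneg (u.jet - v.jet)]
  exact sub_eq_zero.1 (norm_eq_zero.1 h3)

/-- Near a coercive form the Dirichlet problem is solvable. -/
lemma IsCoerciveForm.eventually_exists (hc : IsCoerciveForm γ q hγ hq) {h k : ℂ → ℝ}
    (hh : MemLp h ∞ diskVol) (hk : MemLp k ∞ diskVol) {g : Circle → ℂ} {u : H1}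
    (hu : HasTrace u g) : ∀ᶠ ε : ℝ in 𝓝 0,
      ∃ v, IsFormSol (fun x => γ x + ε * h x) (fun x => q x + ε * k x) g v := by
  obtain ⟨c, hc0, hc⟩ := hc
  filter_upwards [eventually_abs_mul_le ‖formOp (linf h hh) (linf k hk)‖ (half_pos hc0)] with ε hε
  obtain ⟨v, hv, horth⟩ := exists_orthogonal_correction traceZero isClosed_traceZero _
    (half_pos hc0) (coercive_add_smul traceZero _ _ hc hε) u.jet
  obtain ⟨hg, hug⟩ := hasTrace_iff.1 hu
  have hmem := smoothGraph.topologicalClosure.sub_mem hug (mem_traceZero.1 hv)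
  rw [Prod.mk_sub_mk, sub_zero] at hmem
  obtain ⟨z, hz⟩ := exists_jet_eq hmem
  have hz : z.jet = u.jet - v := hz
  refine ⟨z, hasTrace_iff.2 ⟨hg, hz ▸ hmem⟩, ?_⟩
  rw [forall_energy_eq_zero_iff (memLp_add_mul hγ hh ε) (memLp_add_mul hq hk ε),
    linf_add_smul hγ hh, linf_add_smul hq hk, formOp_add_smul, hz]
  exact horth

/-- The derivative of the boundary energy `⟨f, Λ g⟩` with respect to the coefficients is the energy
of the unperturbed solutions with respect to the perturbation of the coefficients. -/
theorem IsCoerciveForm.hasDerivAt_energy (hc : IsCoerciveForm γ q hγ hq) {h k : ℂ → ℝ}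
    (hh : MemLp h ∞ diskVol) (hk : MemLp k ∞ diskVol) {f g : Circle → ℂ} {uf ug E : H1}
    (hf : IsFormSol γ q f uf) (hg : IsFormSol γ q g ug) (hE : HasTrace E f) {u : ℝ → H1}
    (hu : ∀ ε : ℝ, (∃ v, IsFormSol (fun x => γ x + ε * h x) (fun x => q x + ε * k x) g v) →
      IsFormSol (fun x => γ x + ε * h x) (fun x => q x + ε * k x) g (u ε)) :
    HasDerivAt (fun ε : ℝ => energy (fun x => γ x + ε * h x) (fun x => q x + ε * k x) E (u ε))
      (energy h k uf ug) 0 := by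
  have hex := hc.eventually_exists hh hk hg.1
  obtain ⟨c, hc0, hc⟩ := hc
  have key := DiskBorn.hasDerivAt_energy traceZero (formOp (linf γ hγ) (linf q hq))
    (formOp (linf h hh) (linf k hk)) (inner_formOp_symm hγ hq) hc0 hc
    ((forall_energy_eq_zero_iff hγ hq _).1 hf.conj.2) ((forall_energy_eq_zero_iff hγ hq _).1 hg.2)
    (jet_sub_mem_traceZero hE.conj hf.1.conj) (u := fun ε => (u ε).jet) (by
      filter_upwards [hex] with ε hε
      have hs := hu ε hε
      refine ⟨jet_sub_mem_traceZero hs.1 hg.1, ?_⟩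
      have := (forall_energy_eq_zero_iff (memLp_add_mul hγ hh ε) (memLp_add_mul hq hk ε) _).1 hs.2
      rwa [linf_add_smul hγ hh, linf_add_smul hq hk, formOp_add_smul] at this)
  rw [energy_comm, energy_eq_inner hh hk]
  refine key.congr_of_eventuallyEq (Eventually.of_forall fun ε => ?_)
  simp only
  rw [energy_comm, energy_eq_inner (memLp_add_mul hγ hh ε) (memLp_add_mul hq hk ε),
    linf_add_smul hγ hh, linf_add_smul hq hk, formOp_add_smul]

end Coercive

lemma extension_hasTrace {f : Circle → ℂ} {u : H1} (h : HasTrace u f) :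
    HasTrace (extension f) f := Classical.epsilon_spec (p := fun u => HasTrace u f) ⟨u, h⟩

lemma condSol_spec {γ : ℂ → ℝ} {g : Circle → ℂ} (h : ∃ u, IsFormSol γ (fun _ => 0) g u) :
    IsFormSol γ (fun _ => 0) g (condSol γ g) := by
  simp only [← isCondSol_iff] at h ⊢
  exact Classical.epsilon_spec h

lemma schrodingerSol_spec {q : ℂ → ℝ} {g : Circle → ℂ} (h : ∃ u, IsFormSol (fun _ => 1) q g u) :
    IsFormSol (fun _ => 1) q g (schrodingerSol q g) := by
  simp only [← isSchrodingerSol_iff] at h ⊢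
  exact Classical.epsilon_spec h

lemma DtN_eq_energy (γ : ℂ → ℝ) (f g : Circle → ℂ) :
    DtN γ f g = energy γ (fun _ => 0) (extension f) (condSol γ g) := by
  simp [DtN, energy]

lemma DtNS_eq_energy (q : ℂ → ℝ) (f g : Circle → ℂ) :
    DtNS q f g = energy (fun _ => 1) q (extension f) (schrodingerSol q g) := by
  simp [DtNS, energy]

lemma memLp_const_real (c : ℝ) : MemLp (fun _ : ℂ => c) ∞ diskVol := memLp_const c

theorem dPhiReal_eq {σ h : ℂ → ℝ} {hσ : MemLp σ ∞ diskVol}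
    (hc : IsCoerciveForm σ (fun _ => 0) hσ (memLp_const_real 0)) (hh : MemLp h ∞ diskVol)
    {f g : Circle → ℂ} {uf ug : H1} (hf : IsFormSol σ (fun _ => 0) f uf)
    (hg : IsFormSol σ (fun _ => 0) g ug) :
    dPhiReal σ h f g = ∫ x, (h x : ℂ) * gradDot uf ug x ∂diskVol := by
  have key := hc.hasDerivAt_energy hh (memLp_const_real 0) hf hg (extension_hasTrace hf.1)
    (u := fun ε => condSol (fun x => σ x + ε * h x) g) (fun ε hε => by
      simp only [mul_zero, add_zero] at hε ⊢
      exact condSol_spec hε)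
  have e : energy h (fun _ => 0) uf ug = ∫ x, (h x : ℂ) * gradDot uf ug x ∂diskVol := by
    simp [energy]
  rw [← e, dPhiReal, ← key.deriv]
  simp only [mul_zero, add_zero, DtN_eq_energy]

theorem dPhiSReal_eq {q h : ℂ → ℝ} {hq : MemLp q ∞ diskVol}
    (hc : IsCoerciveForm (fun _ => 1) q (memLp_const_real 1) hq) (hh : MemLp h ∞ diskVol)
    {f g : Circle → ℂ} {uf ug : H1} (hf : IsFormSol (fun _ => 1) q f uf)
    (hg : IsFormSol (fun _ => 1) q g ug) :
    dPhiSReal q h f g = ∫ x, (h x : ℂ) * (uf.val x * ug.val x) ∂diskVol := by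
  have key := hc.hasDerivAt_energy (memLp_const_real 0) hh hf hg (extension_hasTrace hf.1)
    (u := fun ε => schrodingerSol (fun x => q x + ε * h x) g) (fun ε hε => by
      simp only [mul_zero, add_zero] at hε ⊢
      exact schrodingerSol_spec hε)
  have e : energy (fun _ => 0) h uf ug = ∫ x, (h x : ℂ) * (uf.val x * ug.val x) ∂diskVol := by
    simp [energy, mul_assoc]
  rw [← e, dPhiSReal, ← key.deriv]
  simp only [mul_zero, add_zero, DtNS_eq_energy]

/-! ### Coercivity -/

/-- The divergence theorem on the disk for real vector fields. -/
lemma integral_divergence_disk_real {Y₁ Y₂ : ℂ → ℝ} (h₁ : ContDiff ℝ 1 Y₁)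
    (h₂ : ContDiff ℝ 1 Y₂) :
    ∫ x, (fderiv ℝ Y₁ x 1 + fderiv ℝ Y₂ x Complex.I) ∂diskVol
      = ∫ θ, (Real.cos θ * Y₁ (Circle.exp θ) + Real.sin θ * Y₂ (Circle.exp θ)) ∂arcLength := by
  have hof : ∀ {Y : ℂ → ℝ}, ContDiff ℝ 1 Y → ∀ x v,
      fderiv ℝ (fun x => (Y x : ℂ)) x v = (fderiv ℝ Y x v : ℂ) := by
    intro Y hY x v
    have h := (Complex.ofRealCLM.hasFDerivAt).comp x (hY.differentiable one_ne_zero x).hasFDerivAt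
    rw [show (fun x => (Y x : ℂ)) = Complex.ofRealCLM ∘ Y from rfl, h.fderiv]
    rfl
  have key := integral_divergence_disk (Complex.ofRealCLM.contDiff.comp h₁)
    (Complex.ofRealCLM.contDiff.comp h₂)
  have e1 : ∀ x, fderiv ℝ (Complex.ofRealCLM ∘ Y₁) x 1 + fderiv ℝ (Complex.ofRealCLM ∘ Y₂) x Complex.I
      = ((fderiv ℝ Y₁ x 1 + fderiv ℝ Y₂ x Complex.I : ℝ) : ℂ) := fun x => by
    rw [Complex.ofReal_add, ← hof h₁, ← hof h₂]
    rfl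
  have e2 : ∀ θ : ℝ, (Real.cos θ : ℂ) * (Complex.ofRealCLM ∘ Y₁) (Circle.exp θ)
        + (Real.sin θ : ℂ) * (Complex.ofRealCLM ∘ Y₂) (Circle.exp θ)
      = ((Real.cos θ * Y₁ (Circle.exp θ) + Real.sin θ * Y₂ (Circle.exp θ) : ℝ) : ℂ) := fun θ => by
    rw [Complex.ofReal_add, Complex.ofReal_mul, Complex.ofReal_mul]
    rfl
  simp only [e1, e2, integral_complex_ofReal] at key
  exact_mod_cast key

/-- Directional derivatives computed along a line. -/
lemma fderiv_eq_of_line {E : Type*} [NormedAddCommGroup E] [NormedSpace ℝ E] {F : ℂ → E} {x v : ℂ}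
    {d : E} (hF : DifferentiableAt ℝ F x) (h : HasDerivAt (fun t : ℝ => F (x + t • v)) d 0) :
    fderiv ℝ F x v = d := by
  rw [← hF.lineDeriv_eq_fderiv]
  exact HasLineDerivAt.lineDeriv h

lemma hasDerivAt_line {E : Type*} [NormedAddCommGroup E] [NormedSpace ℝ E] {F : ℂ → E} {x v : ℂ}
    (hF : DifferentiableAt ℝ F x) :
    HasDerivAt (fun t : ℝ => F (x + t • v)) (fderiv ℝ F x v) 0 :=
  hF.hasFDerivAt.hasLineDerivAt v

lemma hasDerivAt_line_re (x v : ℂ) : HasDerivAt (fun t : ℝ => (x + t • v).re) v.re 0 := by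
  have := (Complex.reCLM.hasFDerivAt (x := x)).hasLineDerivAt v
  exact this

lemma hasDerivAt_line_im (x v : ℂ) : HasDerivAt (fun t : ℝ => (x + t • v).im) v.im 0 := by
  have := (Complex.imCLM.hasFDerivAt (x := x)).hasLineDerivAt v
  exact this

lemma hasDerivAt_line_normSq (x v : ℂ) :
    HasDerivAt (fun t : ℝ => Complex.normSq (x + t • v)) (2 * (x.re * v.re + x.im * v.im)) 0 := by
  have h := ((hasDerivAt_line_re x v).mul (hasDerivAt_line_re x v)).add
    ((hasDerivAt_line_im x v).mul (hasDerivAt_line_im x v))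
  simp only [zero_smul, add_zero] at h
  refine (h.congr_deriv (by ring)).congr_of_eventuallyEq (Eventually.of_forall fun t => ?_)
  exact Complex.normSq_apply _

lemma hasDerivAt_line_radial {Z : ℝ → ℝ} (x v : ℂ) {d : ℝ} (h : HasDerivAt Z d (Complex.normSq x)) :
    HasDerivAt (fun t : ℝ => Z (Complex.normSq (x + t • v)))
      (d * (2 * (x.re * v.re + x.im * v.im))) 0 := by
  have h' : HasDerivAt Z d (Complex.normSq (x + (0 : ℝ) • v)) := by simpa using h
  exact HasDerivAt.comp (0 : ℝ) h' (hasDerivAt_line_normSq x v)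

lemma contDiff_normSq {n : WithTop ℕ∞} : ContDiff ℝ n fun x : ℂ => Complex.normSq x := by
  have : (fun x : ℂ => Complex.normSq x) = fun x : ℂ => Complex.reCLM x * Complex.reCLM x
      + Complex.imCLM x * Complex.imCLM x := funext fun x => Complex.normSq_apply x
  rw [this]
  exact (Complex.reCLM.contDiff.mul Complex.reCLM.contDiff).add
    (Complex.imCLM.contDiff.mul Complex.imCLM.contDiff)

lemma integrable_diskVol_of_continuous {F : ℂ → ℝ} (hF : Continuous F) : Integrable F diskVol := by
  refine IntegrableOn.mono_set (t := Metric.closedBall 0 1) ?_ Metric.ball_subset_closedBall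
  exact hF.continuousOn.integrableOn_compact (isCompact_closedBall _ _)

lemma normSq_lt_one {x : ℂ} (hx : x ∈ disk) : Complex.normSq x < 1 := by
  rw [Complex.normSq_eq_norm_sq]
  have := mem_disk.1 hx
  nlinarith [norm_nonneg x]

/-- Integrating `|∇w - w Z|² ≥ 0` for the radial vector field `Z = ζ(|x|²) x` bounds a weighted
`L²` norm of `w`, with weight `-div Z - |Z|²`, by the Dirichlet integral and boundary values. -/
lemma integral_radial_le {ζ : ℝ → ℝ} (hζ : ContDiff ℝ ∞ ζ) {K : ℝ}
    (hK : ∀ s ∈ Set.Ico (0 : ℝ) 1, 2 * ζ s + 2 * s * deriv ζ s + s * ζ s ^ 2 ≤ -K)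
    {w : ℂ → ℂ} (hw : ContDiff ℝ ∞ w) :
    K * ∫ x, ‖w x‖ ^ 2 ∂diskVol ≤ (∫ x, ‖fderiv ℝ w x 1‖ ^ 2 ∂diskVol)
      + (∫ x, ‖fderiv ℝ w x Complex.I‖ ^ 2 ∂diskVol)
      + |ζ 1| * ∫ θ, ‖w (Circle.exp θ)‖ ^ 2 ∂arcLength := by
  have hw1 : ContDiff ℝ 1 w := hw.of_le (by simp)
  have hζ1 : ContDiff ℝ 1 ζ := hζ.of_le (by simp)
  have hN : ContDiff ℝ 1 fun x => Complex.normSq (w x) := contDiff_normSq.comp hw1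
  have hζN : ContDiff ℝ 1 fun x : ℂ => ζ (Complex.normSq x) := hζ1.comp contDiff_normSq
  have hY₁ : ContDiff ℝ 1 fun x : ℂ => Complex.normSq (w x) * ζ (Complex.normSq x) * x.re :=
    (hN.mul hζN).mul Complex.reCLM.contDiff
  have hY₂ : ContDiff ℝ 1 fun x : ℂ => Complex.normSq (w x) * ζ (Complex.normSq x) * x.im :=
    (hN.mul hζN).mul Complex.imCLM.contDiff
  have hNl : ∀ x v : ℂ, HasDerivAt (fun t : ℝ => Complex.normSq (w (x + t • v)))
      (2 * ((w x).re * (fderiv ℝ w x v).re + (w x).im * (fderiv ℝ w x v).im)) 0 := by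
    intro x v
    have h0 := hasDerivAt_line (v := v) (hw1.differentiable one_ne_zero x)
    have hre := Complex.reCLM.hasFDerivAt.comp_hasDerivAt (0 : ℝ) h0
    have him := Complex.imCLM.hasFDerivAt.comp_hasDerivAt (0 : ℝ) h0
    have h := (hre.mul hre).add (him.mul him)
    refine (h.congr_deriv ?_).congr_of_eventuallyEq (Eventually.of_forall fun t => ?_)
    · simp; ring
    · exact Complex.normSq_apply _
  have hd : ∀ s, HasDerivAt ζ (deriv ζ s) s := fun s => (hζ1.differentiable one_ne_zero s).hasDerivAt
  have hdiv : ∀ x, x ∈ disk →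
      fderiv ℝ (fun x : ℂ => Complex.normSq (w x) * ζ (Complex.normSq x) * x.re) x 1
      + fderiv ℝ (fun x : ℂ => Complex.normSq (w x) * ζ (Complex.normSq x) * x.im) x Complex.I
      ≤ ‖fderiv ℝ w x 1‖ ^ 2 + ‖fderiv ℝ w x Complex.I‖ ^ 2 - K * ‖w x‖ ^ 2 := by
    intro x hx
    rw [fderiv_eq_of_line (hY₁.differentiable one_ne_zero x)
      (((hNl x 1).mul (hasDerivAt_line_radial x 1 (hd _))).mul (hasDerivAt_line_re x 1)),
      fderiv_eq_of_line (hY₂.differentiable one_ne_zero x)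
      (((hNl x Complex.I).mul (hasDerivAt_line_radial x Complex.I (hd _))).mul
        (hasDerivAt_line_im x Complex.I))]
    have hk := hK _ ⟨Complex.normSq_nonneg x, normSq_lt_one hx⟩
    simp only [← Complex.normSq_eq_norm_sq, zero_smul, add_zero, Complex.one_re, Complex.one_im,
      Complex.I_re, Complex.I_im, mul_one, mul_zero, zero_add, Pi.mul_apply]
    have hs : Complex.normSq x = x.re * x.re + x.im * x.im := Complex.normSq_apply x
    set s := Complex.normSq x
    set z := ζ s
    set z' := deriv ζ s
    have h1 := mul_le_mul_of_nonneg_left hk (Complex.normSq_nonneg (w x))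
    simp only [Complex.normSq_apply (w x), Complex.normSq_apply (fderiv ℝ w x 1),
      Complex.normSq_apply (fderiv ℝ w x Complex.I)] at h1 ⊢
    set a := (w x).re
    set b := (w x).im
    set a1 := (fderiv ℝ w x 1).re
    set b1 := (fderiv ℝ w x 1).im
    set a2 := (fderiv ℝ w x Complex.I).re
    set b2 := (fderiv ℝ w x Complex.I).im
    have q1 := sq_nonneg (a1 - a * (z * x.re))
    have q2 := sq_nonneg (b1 - b * (z * x.re))
    have q3 := sq_nonneg (a2 - a * (z * x.im))
    have q4 := sq_nonneg (b2 - b * (z * x.im))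
    rw [hs] at h1
    nlinarith
  have hc0 : Integrable (fun x => ‖w x‖ ^ 2) diskVol :=
    integrable_diskVol_of_continuous (by have := hw.continuous; fun_prop)
  have hc1 : Integrable (fun x => ‖fderiv ℝ w x 1‖ ^ 2) diskVol :=
    integrable_diskVol_of_continuous (by have := continuous_fderiv_dir hw 1; fun_prop)
  have hc2 : Integrable (fun x => ‖fderiv ℝ w x Complex.I‖ ^ 2) diskVol :=
    integrable_diskVol_of_continuous (by have := continuous_fderiv_dir hw Complex.I; fun_prop)
  have hmono := integral_mono_ae (μ := diskVol)
    (integrable_diskVol_of_continuous (((hY₁.continuous_fderiv one_ne_zero).clm_apply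
      continuous_const).add ((hY₂.continuous_fderiv one_ne_zero).clm_apply continuous_const)))
    ((hc1.add hc2).sub (hc0.const_mul K)) (ae_mem_disk.mono hdiv)
  have hb : ∫ θ, (Real.cos θ * (Complex.normSq (w (Circle.exp θ))
        * ζ (Complex.normSq (Circle.exp θ)) * (Circle.exp θ : ℂ).re)
      + Real.sin θ * (Complex.normSq (w (Circle.exp θ))
        * ζ (Complex.normSq (Circle.exp θ)) * (Circle.exp θ : ℂ).im)) ∂arcLength
      = ζ 1 * ∫ θ, ‖w (Circle.exp θ)‖ ^ 2 ∂arcLength := by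
    rw [← integral_const_mul]
    congr 1
    funext θ
    have e1 : (Circle.exp θ : ℂ).re = Real.cos θ := by
      rw [circle_exp_coe, Complex.exp_ofReal_mul_I_re]
    have e2 : (Circle.exp θ : ℂ).im = Real.sin θ := by
      rw [circle_exp_coe, Complex.exp_ofReal_mul_I_im]
    rw [Complex.normSq_eq_norm_sq (Circle.exp θ : ℂ), Circle.norm_coe, one_pow,
      Complex.normSq_eq_norm_sq, e1, e2]
    have := Real.cos_sq_add_sin_sq θ
    linear_combination (‖w (Circle.exp θ)‖ ^ 2 * ζ 1) * this
  have hr : ∫ x, ((fun x => ‖fderiv ℝ w x 1‖ ^ 2) + (fun x => ‖fderiv ℝ w x Complex.I‖ ^ 2)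
        - fun x => K * ‖w x‖ ^ 2) x ∂diskVol
      = (∫ x, ‖fderiv ℝ w x 1‖ ^ 2 ∂diskVol) + (∫ x, ‖fderiv ℝ w x Complex.I‖ ^ 2 ∂diskVol)
        - K * ∫ x, ‖w x‖ ^ 2 ∂diskVol := by
    rw [integral_sub' (hc1.add hc2) (hc0.const_mul K), integral_add' hc1 hc2, integral_const_mul]
  have hmono' := ((hb.symm.trans (integral_divergence_disk_real hY₁ hY₂).symm).le.trans
    hmono).trans hr.le
  have hpos : 0 ≤ ∫ θ, ‖w (Circle.exp θ)‖ ^ 2 ∂arcLength := integral_nonneg fun θ => by positivity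
  have := mul_le_mul_of_nonneg_right (neg_abs_le (ζ 1)) hpos
  linarith

lemma norm_toLp_sq {α : Type*} [MeasurableSpace α] {μ : Measure α} {f : α → ℂ} (hf : MemLp f 2 μ) :
    ‖hf.toLp f‖ ^ 2 = ∫ x, ‖f x‖ ^ 2 ∂μ := by
  have h : inner ℂ (hf.toLp f) (hf.toLp f) = ∫ x, ((‖f x‖ ^ 2 : ℝ) : ℂ) ∂μ := by
    rw [L2.inner_def]
    refine integral_congr_ae ?_
    filter_upwards [hf.coeFn_toLp] with x hx
    rw [hx, inner_self_eq_norm_sq_to_K]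
    push_cast
    rfl
  rw [inner_self_eq_norm_sq_to_K, integral_complex_ofReal] at h
  refine Complex.ofReal_injective (Eq.trans ?_ h)
  push_cast
  rfl

/-- The inequality of `integral_radial_le` on `H¹₀`. -/
lemma traceZero_radial_le {ζ : ℝ → ℝ} (hζ : ContDiff ℝ ∞ ζ) {K : ℝ}
    (hK : ∀ s ∈ Set.Ico (0 : ℝ) 1, 2 * ζ s + 2 * s * deriv ζ s + s * ζ s ^ 2 ≤ -K)
    {x : JetSpace} (hx : x ∈ traceZero) : K * ‖x 0‖ ^ 2 ≤ ‖x 1‖ ^ 2 + ‖x 2‖ ^ 2 := by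
  have hcl : IsClosed {y : JetSpace × L2Circle |
      K * ‖y.1 0‖ ^ 2 ≤ ‖y.1 1‖ ^ 2 + ‖y.1 2‖ ^ 2 + |ζ 1| * ‖y.2‖ ^ 2} := by
    have h0 := continuous_jet_coord 0
    have h1 := continuous_jet_coord 1
    have h2 := continuous_jet_coord 2
    exact isClosed_le (by fun_prop) (by fun_prop)
  have := closure_induction_smooth hcl (fun w hw => ?_) (mem_traceZero.1 hx)
  · simpa using this
  · have e0 := norm_toLp_sq (smoothH1 w hw).val_mem
    have e1 := norm_toLp_sq (smoothH1 w hw).d1_mem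
    have e2 := norm_toLp_sq (smoothH1 w hw).d2_mem
    have e3 := norm_toLp_sq (memLp_arcLength hw.continuous 2)
    have key := integral_radial_le hζ hK hw
    have e : K * ‖(smoothH1 w hw).val_mem.toLp‖ ^ 2 ≤ ‖(smoothH1 w hw).d1_mem.toLp‖ ^ 2
        + ‖(smoothH1 w hw).d2_mem.toLp‖ ^ 2
        + |ζ 1| * ‖(memLp_arcLength hw.continuous 2).toLp‖ ^ 2 := by
      rw [e0, e1, e2, e3]
      exact key
    exact e

/-- The Poincaré inequality on `H¹₀`. -/
lemma traceZero_poincare {x : JetSpace} (hx : x ∈ traceZero) :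
    ‖x 0‖ ^ 2 ≤ ‖x 1‖ ^ 2 + ‖x 2‖ ^ 2 := by
  have := traceZero_radial_le (ζ := fun _ => -1) contDiff_const (K := 1) (fun s hs => ?_) hx
  · simpa using this
  · simp only [deriv_const]
    linarith [hs.2]

lemma exists_positive_extension {F : ℝ → ℝ} (hF : ContDiff ℝ ∞ F)
    (hpos : ∀ s ∈ Set.Icc (0 : ℝ) 1, 0 < F s) :
    ∃ P : ℝ → ℝ, ContDiff ℝ ∞ P ∧ (∀ s, 0 < P s) ∧ ∀ s ∈ Set.Icc (0 : ℝ) 1, P =ᶠ[𝓝 s] F := by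
  have hIcc : Set.Icc (0 : ℝ) 1 = Metric.closedBall (1 / 2) (1 / 2) := by
    rw [Real.closedBall_eq_Icc]; norm_num
  have hopen : IsOpen {s | 0 < F s} := isOpen_lt continuous_const hF.continuous
  obtain ⟨δ, hδ, hsub⟩ := (isCompact_Icc (a := (0 : ℝ)) (b := 1)).exists_thickening_subset_open
    hopen hpos
  rw [hIcc, thickening_closedBall hδ (by norm_num)] at hsub
  let χ : ContDiffBump (1 / 2 : ℝ) := ⟨1 / 2 + δ / 2, 1 / 2 + δ, by positivity, by linarith⟩
  refine ⟨fun s => 1 + χ s * (F s - 1), ?_, fun s => ?_, fun s hs => ?_⟩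
  · exact contDiff_const.add (χ.contDiff.mul (hF.sub contDiff_const))
  · by_cases hs : s ∈ Metric.ball (1 / 2 : ℝ) (δ + 1 / 2)
    · have h1 : 0 < F s := hsub hs
      have h2 := χ.nonneg (x := s)
      have h3 := χ.le_one (x := s)
      rcases h3.lt_or_eq with h | h
      · nlinarith [mul_nonneg h2 h1.le]
      · change 0 < 1 + χ s * (F s - 1)
        rw [h]
        linarith
    · have : χ s = 0 := χ.zero_of_le_dist (by
        simp only [Metric.mem_ball, not_lt] at hs
        change 1 / 2 + δ ≤ _
        linarith)
      simp [this]
  · have : ∀ᶠ t in 𝓝 s, t ∈ Metric.ball (1 / 2 : ℝ) (1 / 2 + δ / 2) := by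
      refine Metric.isOpen_ball.mem_nhds ?_
      rw [hIcc] at hs
      exact Metric.closedBall_subset_ball (by linarith) hs
    filter_upwards [this] with t ht
    rw [χ.one_of_mem_closedBall (Metric.ball_subset_closedBall ht)]
    ring

lemma hasDerivAt_besselB_mul (n : ℕ) (κ s : ℝ) :
    HasDerivAt (fun s => besselB n (κ * s)) (-(κ / 4) * besselB (n + 1) (κ * s)) s := by
  have h := (hasDerivAt_besselB n (κ * s)).comp s ((hasDerivAt_id s).const_mul κ)
  refine h.congr_deriv ?_
  ring

lemma contDiff_besselB_mul (n : ℕ) (κ : ℝ) : ContDiff ℝ ∞ fun s => besselB n (κ * s) :=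
  (contDiff_besselB n).comp (contDiff_const.mul contDiff_id)

/-- A positive smooth function on the line that agrees with `s ↦ J₀(√κ √s)` near `[0, 1]`. -/
lemma exists_besselB_extension {κ : ℝ} (hκ : κ < besselZero ^ 2) :
    ∃ P : ℝ → ℝ, ContDiff ℝ ∞ P ∧ (∀ s, 0 < P s) ∧
      ∀ s ∈ Set.Icc (0 : ℝ) 1, P =ᶠ[𝓝 s] fun s => besselB 0 (κ * s) :=
  exists_positive_extension (contDiff_besselB_mul 0 κ)
    fun _ hs => besselB_mul_pos 0 hκ hs.1 hs.2

/-- First and second derivatives of an extension of `s ↦ B_n(κ s)`. -/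
lemma hasDerivAt_of_eventuallyEq_besselB {P : ℝ → ℝ} {n : ℕ} {κ s : ℝ}
    (h : P =ᶠ[𝓝 s] fun s => besselB n (κ * s)) :
    P s = besselB n (κ * s) ∧ deriv P s = -(κ / 4) * besselB (n + 1) (κ * s) ∧
      HasDerivAt (deriv P) (-(κ / 4) * (-(κ / 4) * besselB (n + 2) (κ * s))) s := by
  refine ⟨h.self_of_nhds, h.deriv_eq.trans (hasDerivAt_besselB_mul n κ s).deriv, ?_⟩
  have h2 : deriv (fun s => besselB n (κ * s)) = fun s => -(κ / 4) * besselB (n + 1) (κ * s) :=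
    funext fun t => (hasDerivAt_besselB_mul n κ t).deriv
  have h3 := h.deriv
  rw [h2] at h3
  exact ((hasDerivAt_besselB_mul (n + 1) κ s).const_mul _).congr_of_eventuallyEq h3

lemma contDiff_deriv {P : ℝ → ℝ} (hP : ContDiff ℝ ∞ P) : ContDiff ℝ ∞ (deriv P) :=
  (contDiff_infty_iff_deriv.1 hP).2

/-- Below the square of the first zero of `J₀` the first Dirichlet eigenvalue is not reached: the
vector field `∇p / p` for the positive solution `p = J₀(√κ |x|)` of `-Δp = κ p` satisfies
`-div Z - |Z|² = κ`. -/
lemma traceZero_bessel_le {κ : ℝ} (hκ : κ < besselZero ^ 2) {x : JetSpace} (hx : x ∈ traceZero) :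
    κ * ‖x 0‖ ^ 2 ≤ ‖x 1‖ ^ 2 + ‖x 2‖ ^ 2 := by
  obtain ⟨P, hP, hpos, hPB⟩ := exists_besselB_extension hκ
  refine traceZero_radial_le (ζ := fun s => 2 * deriv P s / P s)
    ((contDiff_const.mul (contDiff_deriv hP)).div hP fun s => (hpos s).ne') (fun s hs => ?_) hx
  obtain ⟨e0, e1, e2⟩ := hasDerivAt_of_eventuallyEq_besselB (hPB s ⟨hs.1, hs.2.le⟩)
  have hP1 := (hP.differentiable (by simp) s).hasDerivAt
  have hd := ((e2.const_mul 2).div hP1 (hpos s).ne').deriv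
  have hd' : deriv (fun s => 2 * deriv P s / P s) s = _ := hd
  rw [hd']
  have hPs := (hpos s).ne'
  have hrec := besselB_rec 0 (κ * s)
  rw [e0] at hPs
  rw [e1, e0]
  refine le_of_eq ?_
  field_simp
  rw [hrec]
  ring

theorem isCoerciveForm_schrodinger {κ : ℝ} (hκ : κ < besselZero ^ 2) :
    IsCoerciveForm (fun _ => 1) (fun _ => -κ) (memLp_const_real 1) (memLp_const_real (-κ)) := by
  set κ' := (κ + besselZero ^ 2) / 2 with hκ'
  have h1 : κ < κ' := by linarith
  have h2 : κ' < besselZero ^ 2 := by linarith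
  -- a fraction `t` of the Dirichlet integral is kept, the rest absorbs the potential
  set t := (κ' - κ) / (2 * (|κ'| + |κ' - κ| + 1)) with ht
  have hden : 0 < 2 * (|κ'| + |κ' - κ| + 1) := by positivity
  have ht0 : 0 < t := div_pos (by linarith) hden
  have ht1 : t ≤ 1 := by
    rw [ht, div_le_one hden]
    linarith [le_abs_self (κ' - κ), abs_nonneg κ', abs_nonneg (κ' - κ)]
  have htκ : t * κ' ≤ (κ' - κ) / 2 := by
    have : t * κ' ≤ t * (|κ'| + |κ' - κ| + 1) :=
      mul_le_mul_of_nonneg_left (by linarith [le_abs_self κ', abs_nonneg (κ' - κ)]) ht0.le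
    refine this.trans (le_of_eq ?_)
    rw [ht]
    field_simp
  refine ⟨min t ((κ' - κ) / 2), lt_min ht0 (by linarith), fun x hx => ?_⟩
  have hb := traceZero_bessel_le h2 hx
  have hinner : (inner ℂ x (formOp (linf (fun _ => 1) (memLp_const_real 1))
      (linf (fun _ => -κ) (memLp_const_real (-κ))) x)).re
      = ‖x 1‖ ^ 2 + ‖x 2‖ ^ 2 - κ * ‖x 0‖ ^ 2 := by
    have hm : ∀ (c : ℝ) (f : L2Disk), mulOp (linf (fun _ => c) (memLp_const_real c)) f
        = (c : ℂ) • f := by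
      intro c f
      refine Lp.ext ?_
      filter_upwards [mulOp_coe (linf (fun _ => c) (memLp_const_real c)) f,
        linf_coe (memLp_const_real c), Lp.coeFn_smul (c : ℂ) f] with x h1 h2 h3
      rw [h1, h2, h3]
      rfl
    have hself : ∀ f : L2Disk, inner ℂ f f = ((‖f‖ ^ 2 : ℝ) : ℂ) := fun f => by
      rw [inner_self_eq_norm_sq_to_K]
      push_cast
      rfl
    rw [inner_formOp]
    simp only [hm, inner_smul_right, hself]
    rw [← Complex.ofReal_mul, ← Complex.ofReal_mul, ← Complex.ofReal_mul, ← Complex.ofReal_add,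
      ← Complex.ofReal_add, Complex.ofReal_re]
    ring
  rw [hinner, PiLp.norm_sq_eq_of_L2, Fin.sum_univ_three]
  set A := ‖x 0‖ ^ 2
  set G := ‖x 1‖ ^ 2 + ‖x 2‖ ^ 2 with hG
  have hA : 0 ≤ A := by positivity
  have hG0 : 0 ≤ G := by positivity
  have m1 := mul_le_mul_of_nonneg_right (min_le_left t ((κ' - κ) / 2)) hG0
  have m2 := mul_le_mul_of_nonneg_right (min_le_right t ((κ' - κ) / 2)) hA
  have m3 := mul_le_mul_of_nonneg_left hb (sub_nonneg.2 ht1)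
  have m4 := mul_le_mul_of_nonneg_right htκ hA
  nlinarith

theorem isCoerciveForm_conductivity {σ : ℂ → ℝ} (hσ : MemLp σ ∞ diskVol) {c : ℝ} (hc : 0 < c)
    (hσc : ∀ᵐ x ∂diskVol, c ≤ σ x) :
    IsCoerciveForm σ (fun _ => 0) hσ (memLp_const_real 0) := by
  refine ⟨c / 2, half_pos hc, fun x hx => ?_⟩
  have hp := traceZero_poincare hx
  have h0 : mulOp (linf (fun _ => 0) (memLp_const_real 0)) (x 0) = 0 := by
    refine Lp.ext ?_
    filter_upwards [mulOp_coe (linf (fun _ => 0) (memLp_const_real 0)) (x 0),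
      linf_coe (memLp_const_real 0), Lp.coeFn_zero ℂ 2 diskVol] with x h1 h2 h3
    rw [h1, h2, h3]
    simp
  have hm : ∀ f : L2Disk, c * ‖f‖ ^ 2 ≤ (inner ℂ f (mulOp (linf σ hσ) f)).re := by
    intro f
    have e : inner ℂ f (mulOp (linf σ hσ) f) = ∫ x, ((σ x * ‖f x‖ ^ 2 : ℝ) : ℂ) ∂diskVol := by
      rw [L2.inner_def]
      refine integral_congr_ae ?_
      filter_upwards [mulOp_coe (linf σ hσ) f, linf_coe hσ] with x h1 h2
      rw [h1, h2, RCLike.inner_apply, mul_assoc, Complex.mul_conj]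
      push_cast
      rw [Complex.normSq_eq_norm_sq]
      push_cast
      rfl
    have hint : Integrable (fun x => ‖f x‖ ^ 2) diskVol := (Lp.memLp f).integrable_norm_pow two_ne_zero
    have hint2 : Integrable (fun x => σ x * ‖f x‖ ^ 2) diskVol := by
      have := MemLp.integrable_mul (p := ∞) (q := 1) hσ (memLp_one_iff_integrable.2 hint)
      exact this
    have hn : ‖f‖ ^ 2 = ∫ x, ‖f x‖ ^ 2 ∂diskVol := by
      conv_lhs => rw [← Lp.toLp_coeFn f (Lp.memLp f)]
      exact norm_toLp_sq _
    rw [e, integral_complex_ofReal, Complex.ofReal_re, hn, ← integral_const_mul]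
    refine integral_mono_ae (hint.const_mul c) hint2 ?_
    filter_upwards [hσc] with x hx
    exact mul_le_mul_of_nonneg_right hx (by positivity)
  rw [inner_formOp, h0, inner_zero_right, zero_add, Complex.add_re, PiLp.norm_sq_eq_of_L2,
    Fin.sum_univ_three]
  have h1 := hm (x 1)
  have h2 := hm (x 2)
  nlinarith

/-! ### Separated solutions -/

/-- The sign of `m`, with `0` counted as positive. -/
def orient (m : ℤ) : ℂ := if 0 ≤ m then 1 else -1

lemma orient_sq (m : ℤ) : orient m ^ 2 = 1 := by
  unfold orient
  split_ifs <;> norm_num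

lemma orient_mul_natAbs (m : ℤ) : orient m * (m.natAbs : ℂ) = m := by
  unfold orient
  split_ifs with h
  · have : ((m.natAbs : ℤ) : ℂ) = (m : ℂ) := by rw [Int.natAbs_of_nonneg h]
    rw [one_mul, ← this, Int.cast_natCast]
  · push Not at h
    have : ((m.natAbs : ℤ) : ℂ) = ((-m : ℤ) : ℂ) := by rw [Int.ofNat_natAbs_of_nonpos h.le]
    rw [neg_one_mul, neg_eq_iff_eq_neg, ← Int.cast_neg, ← this, Int.cast_natCast]

/-- The real-linear coordinate that is `x` for `m ≥ 0` and the conjugate of `x` for `m < 0`. -/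
def twist (m : ℤ) (x : ℂ) : ℂ := (x.re : ℂ) + orient m * Complex.I * (x.im : ℂ)

lemma twist_of_nonneg {m : ℤ} (h : 0 ≤ m) (x : ℂ) : twist m x = x := by
  rw [twist, orient, if_pos h, one_mul, mul_comm, Complex.re_add_im]

lemma twist_of_neg {m : ℤ} (h : ¬ 0 ≤ m) (x : ℂ) : twist m x = conj x := by
  rw [twist, orient, if_neg h]
  apply Complex.ext <;> simp

lemma contDiff_twist (m : ℤ) : ContDiff ℝ ∞ (twist m) :=
  (Complex.ofRealCLM.contDiff.comp Complex.reCLM.contDiff).add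
    (contDiff_const.mul (Complex.ofRealCLM.contDiff.comp Complex.imCLM.contDiff))

/-- The harmonic function `r^|m| e^{imθ}`. -/
def solidHarmonic (m : ℤ) (x : ℂ) : ℂ := twist m x ^ m.natAbs

lemma contDiff_solidHarmonic (m : ℤ) : ContDiff ℝ ∞ (solidHarmonic m) :=
  (contDiff_twist m).pow _

/-- The derivative of `z ↦ z^|m|` at `twist m x`. -/
def solidDeriv (m : ℤ) (x : ℂ) : ℂ := (m.natAbs : ℂ) * twist m x ^ (m.natAbs - 1)

lemma solidDeriv_mul_twist (m : ℤ) (x : ℂ) :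
    solidDeriv m x * twist m x = (m.natAbs : ℂ) * solidHarmonic m x := by
  unfold solidDeriv solidHarmonic
  rcases Nat.eq_zero_or_pos m.natAbs with h | h
  · simp [h]
  · rw [mul_assoc, pow_sub_one_mul h.ne']

lemma hasDerivAt_line_twist (m : ℤ) (x v : ℂ) :
    HasDerivAt (fun t : ℝ => twist m (x + t • v)) (twist m v) 0 :=
  (hasDerivAt_line_re x v).ofReal_comp.add ((hasDerivAt_line_im x v).ofReal_comp.const_mul _)

lemma hasDerivAt_line_solidHarmonic (m : ℤ) (x v : ℂ) :
    HasDerivAt (fun t : ℝ => solidHarmonic m (x + t • v)) (solidDeriv m x * twist m v) 0 := by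
  have h := (hasDerivAt_line_twist m x v).pow m.natAbs
  rw [zero_smul, add_zero] at h
  exact h

lemma exists_hasDerivAt_line_solidDeriv (m : ℤ) (x : ℂ) : ∃ k : ℂ, ∀ v : ℂ,
    HasDerivAt (fun t : ℝ => solidDeriv m (x + t • v)) (k * twist m v) 0 := by
  refine ⟨(m.natAbs : ℂ) * (((m.natAbs - 1 : ℕ) : ℂ) * twist m x ^ (m.natAbs - 1 - 1)),
    fun v => ?_⟩
  have h := ((hasDerivAt_line_twist m x v).pow (m.natAbs - 1)).const_mul (m.natAbs : ℂ)
  rw [zero_smul, add_zero, ← mul_assoc] at h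
  exact h

/-- The function `A(|x|²) r^|m| e^{imθ}`. -/
def separated (m : ℤ) (A : ℝ → ℝ) (x : ℂ) : ℂ := (A (Complex.normSq x) : ℂ) * solidHarmonic m x

/-- The directional derivative of `separated m A`. -/
def separatedDeriv (m : ℤ) (A : ℝ → ℝ) (v x : ℂ) : ℂ :=
  ((deriv A (Complex.normSq x) : ℝ) : ℂ) * (2 * (x.re * v.re + x.im * v.im) : ℝ) * solidHarmonic m x
    + (A (Complex.normSq x) : ℂ) * (solidDeriv m x * twist m v)

lemma contDiff_radial {A : ℝ → ℝ} (hA : ContDiff ℝ ∞ A) :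
    ContDiff ℝ ∞ fun x : ℂ => (A (Complex.normSq x) : ℂ) :=
  Complex.ofRealCLM.contDiff.comp (hA.comp contDiff_normSq)

lemma contDiff_separated (m : ℤ) {A : ℝ → ℝ} (hA : ContDiff ℝ ∞ A) :
    ContDiff ℝ ∞ (separated m A) := (contDiff_radial hA).mul (contDiff_solidHarmonic m)

lemma hasDerivAt_line_radial_ofReal {A : ℝ → ℝ} (hA : ContDiff ℝ ∞ A) (x v : ℂ) :
    HasDerivAt (fun t : ℝ => (A (Complex.normSq (x + t • v)) : ℂ))
      (((deriv A (Complex.normSq x) : ℝ) : ℂ) * (2 * (x.re * v.re + x.im * v.im) : ℝ)) 0 := by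
  have h := (hasDerivAt_line_radial x v
    (hA.differentiable (by simp) (Complex.normSq x)).hasDerivAt).ofReal_comp
  rwa [Complex.ofReal_mul] at h

lemma fderiv_separated (m : ℤ) {A : ℝ → ℝ} (hA : ContDiff ℝ ∞ A) (x v : ℂ) :
    fderiv ℝ (separated m A) x v = separatedDeriv m A v x := by
  refine fderiv_eq_of_line ((contDiff_separated m hA).differentiable (by simp) x) ?_
  have h := (hasDerivAt_line_radial_ofReal hA x v).mul (hasDerivAt_line_solidHarmonic m x v)
  simp only [zero_smul, add_zero] at h
  exact h

lemma contDiff_separatedDeriv (m : ℤ) {A : ℝ → ℝ} (hA : ContDiff ℝ ∞ A) (v : ℂ) :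
    ContDiff ℝ ∞ (separatedDeriv m A v) := by
  have : separatedDeriv m A v = fun x => fderiv ℝ (separated m A) x v :=
    funext fun x => (fderiv_separated m hA x v).symm
  rw [this]
  exact ((contDiff_separated m hA).fderiv_right (m := (⊤ : ℕ∞)) (by simp)).clm_apply contDiff_const

/-- The divergence of `w W ∇U` for `U = A(|x|²) r^|m| e^{imθ}` and a radial weight `W`, when `A`
satisfies the radial form of the equation `∇·(W ∇U) = q U`. -/
lemma divergence_separated (m : ℤ) {A W : ℝ → ℝ} (hA : ContDiff ℝ ∞ A) (hW : ContDiff ℝ ∞ W)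
    {q : ℝ} {w : ℂ → ℂ} (hw : ContDiff ℝ ∞ w) {x : ℂ}
    (hode : 4 * (Complex.normSq x * (deriv W (Complex.normSq x) * deriv A (Complex.normSq x)
        + W (Complex.normSq x) * deriv (deriv A) (Complex.normSq x))
        + W (Complex.normSq x) * deriv A (Complex.normSq x))
      + 4 * m.natAbs * W (Complex.normSq x) * deriv A (Complex.normSq x)
      + 2 * m.natAbs * deriv W (Complex.normSq x) * A (Complex.normSq x)
      = q * A (Complex.normSq x)) :
    fderiv ℝ (fun x => w x * ((W (Complex.normSq x) : ℂ) * separatedDeriv m A 1 x)) x 1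
      + fderiv ℝ (fun x => w x * ((W (Complex.normSq x) : ℂ) * separatedDeriv m A Complex.I x)) x
        Complex.I
      = (W (Complex.normSq x) : ℂ) * (separatedDeriv m A 1 x * fderiv ℝ w x 1
          + separatedDeriv m A Complex.I x * fderiv ℝ w x Complex.I)
        + (q : ℂ) * separated m A x * w x := by
  obtain ⟨k, hk⟩ := exists_hasDerivAt_line_solidDeriv m x
  have hdA := contDiff_deriv hA
  have hV : ∀ v : ℂ, HasDerivAt (fun t : ℝ => separatedDeriv m A v (x + t • v))
      ((((deriv (deriv A) (Complex.normSq x) : ℝ) : ℂ) * (2 * (x.re * v.re + x.im * v.im) : ℝ)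
          * (2 * (x.re * v.re + x.im * v.im) : ℝ)
        + ((deriv A (Complex.normSq x) : ℝ) : ℂ) * (2 * (v.re * v.re + v.im * v.im) : ℝ))
          * solidHarmonic m x
        + ((deriv A (Complex.normSq x) : ℝ) : ℂ) * (2 * (x.re * v.re + x.im * v.im) : ℝ)
          * (solidDeriv m x * twist m v)
        + (((deriv A (Complex.normSq x) : ℝ) : ℂ) * (2 * (x.re * v.re + x.im * v.im) : ℝ)
          * (solidDeriv m x * twist m v)
        + (A (Complex.normSq x) : ℂ) * (k * twist m v * twist m v))) 0 := by
    intro v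
    have h1 := hasDerivAt_line_radial_ofReal hdA x v
    have h2 := ((((hasDerivAt_line_re x v).mul_const v.re).add
      ((hasDerivAt_line_im x v).mul_const v.im)).const_mul 2).ofReal_comp
    have h3 := hasDerivAt_line_solidHarmonic m x v
    have h4 := hasDerivAt_line_radial_ofReal hA x v
    have h5 := (hk v).mul_const (twist m v)
    have h := ((h1.mul h2).mul h3).add (h4.mul h5)
    simp only [zero_smul, add_zero, Pi.mul_apply, Pi.add_apply] at h
    exact h
  have hY : ∀ v : ℂ, fderiv ℝ (fun x => w x * ((W (Complex.normSq x) : ℂ)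
      * separatedDeriv m A v x)) x v = _ := fun v => by
    refine fderiv_eq_of_line ((hw.mul ((contDiff_radial hW).mul
      (contDiff_separatedDeriv m hA v))).differentiable (by simp) x) ?_
    have h := (hasDerivAt_line (v := v) (hw.differentiable (by simp) x)).mul
      ((hasDerivAt_line_radial_ofReal hW x v).mul (hV v))
    simp only [zero_smul, add_zero, Pi.mul_apply] at h
    exact h
  rw [hY 1, hY Complex.I]
  have ht1 : twist m 1 = 1 := by simp [twist]
  have htI : twist m Complex.I = orient m * Complex.I := by simp [twist]
  have htx : twist m x = (x.re : ℂ) + orient m * Complex.I * (x.im : ℂ) := rfl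
  have hsx : (Complex.normSq x : ℂ) = x.re * x.re + x.im * x.im := by
    rw [Complex.normSq_apply]; push_cast; ring
  have hode' := congrArg (fun r : ℝ => (r : ℂ)) hode
  push_cast at hode'
  have heul := solidDeriv_mul_twist m x
  have ho := orient_sq m
  have hI := Complex.I_sq
  simp only [separatedDeriv, separated, ht1, htI, Complex.one_re, Complex.one_im, Complex.I_re,
    Complex.I_im, mul_one, mul_zero, add_zero, zero_add, Complex.ofReal_mul, Complex.ofReal_ofNat]
  rw [htx] at heul
  rw [hsx] at hode'
  generalize ((deriv (deriv A) (Complex.normSq x) : ℝ) : ℂ) = A2 at *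
  generalize ((deriv A (Complex.normSq x) : ℝ) : ℂ) = A1 at *
  generalize (A (Complex.normSq x) : ℂ) = A0 at *
  generalize ((deriv W (Complex.normSq x) : ℝ) : ℂ) = W1 at *
  generalize (W (Complex.normSq x) : ℂ) = W0 at *
  generalize solidDeriv m x = d at *
  generalize solidHarmonic m x = H at *
  generalize orient m = o at *
  generalize (x.re : ℂ) = x1 at *
  generalize (x.im : ℂ) = x2 at *
  linear_combination (w x * H) * hode' + (w x * (2 * W1 * A0 + 4 * W0 * A1)) * heul
    + (w x * W0 * A0 * k) * (o ^ 2 * hI - ho)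

/-- Functions `A(|x|²) r^|m| e^{imθ}` with `A` solving the radial equation are weak solutions: by
the divergence theorem the energy against smooth functions is a boundary integral, and the identity
passes to the closure. -/
theorem isFormSol_separated (m : ℤ) {A W : ℝ → ℝ} (hA : ContDiff ℝ ∞ A) (hW : ContDiff ℝ ∞ W)
    {q : ℝ} (hode : ∀ s ∈ Set.Ico (0 : ℝ) 1,
      4 * (s * (deriv W s * deriv A s + W s * deriv (deriv A) s) + W s * deriv A s)
        + 4 * m.natAbs * W s * deriv A s + 2 * m.natAbs * deriv W s * A s = q * A s)
    {f : Circle → ℂ} (hf : ∀ z : Circle, separated m A z = f z) :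
    IsFormSol (fun x => W (Complex.normSq x)) (fun _ => q) f
      (smoothH1 (separated m A) (contDiff_separated m hA)) := by
  refine ⟨hasTrace_smooth _ hf, fun u hu => ?_⟩
  have hWc : ContDiff ℝ ∞ fun x : ℂ => W (Complex.normSq x) := hW.comp contDiff_normSq
  have hWm : MemLp (fun x : ℂ => W (Complex.normSq x)) ∞ diskVol := by
    have := (memLp_diskVol (contDiff_radial hW).continuous ∞).re
    exact this
  set U := smoothH1 (separated m A) (contDiff_separated m hA) with hU
  -- the conormal derivative of the solution on the circle
  set β : ℂ → ℂ := fun x => (x.re : ℂ) * ((W (Complex.normSq x) : ℂ) * separatedDeriv m A 1 x)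
    + (x.im : ℂ) * ((W (Complex.normSq x) : ℂ) * separatedDeriv m A Complex.I x) with hβ
  have hβc : Continuous β := by
    have h1 := (contDiff_separatedDeriv m hA 1).continuous
    have h2 := (contDiff_separatedDeriv m hA Complex.I).continuous
    have h3 := (contDiff_radial hW).continuous
    fun_prop
  have hβs : Continuous fun x => conj (β x) := Complex.continuous_conj.comp hβc
  have hβm := memLp_arcLength hβs 2
  have key := closure_induction_smooth (S := {y : JetSpace × L2Circle |
      inner ℂ U.conj.jet (formOp (linf _ hWm) (linf _ (memLp_const_real q)) y.1)
        = inner ℂ (hβm.toLp) y.2}) ?_ (fun w hw => ?_) (mem_traceZero.1 (memH10_iff.1 hu))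
  · rw [energy_comm, energy_eq_inner hWm (memLp_const_real q)]
    have key' : _ = _ := key
    rw [key', inner_zero_right]
  · exact isClosed_eq (continuous_const.inner ((formOp _ _).continuous.comp continuous_fst))
      (continuous_const.inner continuous_snd)
  · change inner ℂ U.conj.jet (formOp (linf _ hWm) (linf _ (memLp_const_real q)) (smoothH1 w hw).jet)
        = inner ℂ (hβm.toLp) ((memLp_arcLength hw.continuous 2).toLp)
    rw [← energy_eq_inner, L2.inner_def]
    have e1 : ∫ θ, inner ℂ ((hβm.toLp : L2Circle) θ)
          (((memLp_arcLength hw.continuous 2).toLp : L2Circle) θ) ∂arcLength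
        = ∫ θ, ((Real.cos θ : ℂ) * (w (Circle.exp θ) * ((W (Complex.normSq (Circle.exp θ)) : ℂ)
            * separatedDeriv m A 1 (Circle.exp θ)))
          + (Real.sin θ : ℂ) * (w (Circle.exp θ) * ((W (Complex.normSq (Circle.exp θ)) : ℂ)
            * separatedDeriv m A Complex.I (Circle.exp θ)))) ∂arcLength := by
      refine integral_congr_ae ?_
      filter_upwards [hβm.coeFn_toLp, (memLp_arcLength hw.continuous 2).coeFn_toLp] with θ h1 h2
      rw [h1, h2, RCLike.inner_apply, Complex.conj_conj]
      have c1 : (Circle.exp θ : ℂ).re = Real.cos θ := by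
        rw [circle_exp_coe, Complex.exp_ofReal_mul_I_re]
      have c2 : (Circle.exp θ : ℂ).im = Real.sin θ := by
        rw [circle_exp_coe, Complex.exp_ofReal_mul_I_im]
      simp only [hβ, c1, c2]
      ring
    rw [e1, ← integral_divergence_disk
      ((hw.mul ((contDiff_radial hW).mul (contDiff_separatedDeriv m hA 1))).of_le (by simp))
      ((hw.mul ((contDiff_radial hW).mul (contDiff_separatedDeriv m hA Complex.I))).of_le (by simp))]
    refine integral_congr_ae ?_
    filter_upwards [ae_mem_disk] with x hx
    rw [divergence_separated m hA hW hw (hode _ ⟨Complex.normSq_nonneg x, normSq_lt_one hx⟩)]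
    simp only [gradDot, hU, smoothH1, fderiv_separated m hA]
    ring

/-! ### Bessel modes -/

lemma sqrtC_ne_zero {κ : ℝ} (h : κ ≠ 0) : sqrtC κ ≠ 0 := fun h0 => by
  have := sqrtC_sq κ
  rw [h0, zero_pow two_ne_zero] at this
  exact h (by exact_mod_cast this.symm)

lemma sigma_eq (κ : ℝ) (x : ℂ) : sigma κ x = besselB 0 (κ * Complex.normSq x) ^ 2 := by
  rw [sigma, besselJ_sqrtC_mul, pow_zero, one_mul, ← Complex.ofReal_pow, Complex.ofReal_re,
    Complex.normSq_eq_norm_sq]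

lemma phi_eq {κ : ℝ} (hκ : κ < besselZero ^ 2) (m : ℤ) (r : ℝ) :
    phi κ m r = (r : ℂ) ^ m.natAbs
      * ((besselB m.natAbs (κ * r ^ 2) / besselB m.natAbs κ : ℝ) : ℂ) := by
  have hB := (besselB_pos_at m.natAbs hκ).ne'
  unfold phi
  split_ifs with h
  · subst h
    rw [zero_mul, div_self hB, Complex.ofReal_one, mul_one]
  · rw [besselJ_sqrtC_mul, besselJ_eq_of_sq_eq _ (sqrtC_sq κ)]
    have hz := sqrtC_ne_zero h
    have hB' : (besselB m.natAbs κ : ℂ) ≠ 0 := by exact_mod_cast hB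
    rw [Complex.ofReal_div, mul_div_right_comm (sqrtC κ), mul_pow]
    have hz' : (sqrtC κ / 2) ^ m.natAbs ≠ 0 := pow_ne_zero _ (div_ne_zero hz two_ne_zero)
    field_simp

lemma psi_eq {κ : ℝ} (hκ : κ < besselZero ^ 2) (m : ℤ) {r : ℝ} (h0 : 0 ≤ r) (h1 : r ≤ 1) :
    psi κ m r = ((κ * r ^ 2 / 2 * (besselB 1 (κ * r ^ 2) / besselB 0 (κ * r ^ 2)
      - besselB (m.natAbs + 1) (κ * r ^ 2) / besselB m.natAbs (κ * r ^ 2)) : ℝ) : ℂ) := by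
  have hsq : (sqrtC κ * r) ^ 2 = ((κ * r ^ 2 : ℝ) : ℂ) := by
    rw [mul_pow, sqrtC_sq]; push_cast; ring
  have hr2 : r ^ 2 ≤ 1 := pow_le_one₀ h0 h1
  have hB0 : (besselB 0 (κ * r ^ 2) : ℂ) ≠ 0 := by
    exact_mod_cast (besselB_mul_pos 0 hκ (sq_nonneg r) hr2).ne'
  have hBn : (besselB m.natAbs (κ * r ^ 2) : ℂ) ≠ 0 := by
    exact_mod_cast (besselB_mul_pos m.natAbs hκ (sq_nonneg r) hr2).ne'
  unfold psi
  simp only [besselJ_sqrtC_mul]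
  push_cast at hsq ⊢
  rw [← hsq]
  by_cases hz : sqrtC κ * r = 0
  · simp [hz]
  · have hz' : sqrtC κ * r / 2 ≠ 0 := div_ne_zero hz two_ne_zero
    generalize sqrtC κ * (r : ℂ) = z at *
    rw [pow_zero, one_mul, pow_one, pow_succ (z / 2)]
    have hzn : (z / 2) ^ m.natAbs ≠ 0 := pow_ne_zero _ hz'
    have e : (z / 2) ^ m.natAbs * (z / 2) * (besselB (m.natAbs + 1) (κ * r ^ 2) : ℂ)
        / ((z / 2) ^ m.natAbs * (besselB m.natAbs (κ * r ^ 2) : ℂ))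
        = z / 2 * (besselB (m.natAbs + 1) (κ * r ^ 2) : ℂ) / (besselB m.natAbs (κ * r ^ 2) : ℂ) := by
      rw [mul_assoc, mul_div_mul_left _ _ hzn]
    rw [e]
    ring

lemma sqrt_two_pi_ne_zero : (Real.sqrt (2 * Real.pi) : ℂ) ≠ 0 := by
  exact_mod_cast (Real.sqrt_pos.2 (by positivity)).ne'

lemma pow_mul_eHom (m : ℤ) (x : ℂ) :
    (‖x‖ : ℂ) ^ m.natAbs * eHom m x = solidHarmonic m x / (Real.sqrt (2 * Real.pi) : ℂ) := by
  unfold eHom solidHarmonic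
  rw [← mul_div_assoc]
  congr 1
  have hxx : (‖x‖ : ℂ) * ‖x‖ = x * conj x := by
    rw [Complex.mul_conj, Complex.normSq_eq_norm_sq]; push_cast; ring
  by_cases h : 0 ≤ m
  · rw [twist_of_nonneg h]
    obtain ⟨n, rfl⟩ := Int.eq_ofNat_of_zero_le h
    rw [Int.natAbs_natCast, zpow_natCast, ← mul_pow]
    by_cases hx : x = 0
    · simp [hx]
    · have : (‖x‖ : ℂ) ≠ 0 := by simpa using hx
      rw [mul_div_cancel₀ _ this]
  · rw [twist_of_neg h]
    obtain ⟨n, rfl⟩ : ∃ n : ℕ, m = -(n : ℤ) := ⟨m.natAbs, by omega⟩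
    rw [Int.natAbs_neg, Int.natAbs_natCast, zpow_neg, zpow_natCast, ← inv_pow, ← mul_pow]
    by_cases hx : x = 0
    · simp [hx]
    · rw [inv_div, ← mul_div_assoc, hxx, mul_div_cancel_left₀ _ hx]

lemma conj_eHom (l : ℤ) (x : ℂ) : conj (eHom l x) = eHom (-l) x := by
  unfold eHom
  rw [map_div₀, Complex.conj_ofReal, map_zpow₀, map_div₀, Complex.conj_ofReal, zpow_neg,
    ← inv_zpow, inv_div]
  congr 2
  by_cases hx : x = 0
  · simp [hx]
  · have : (‖x‖ : ℂ) ≠ 0 := by simpa using hx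
    rw [div_eq_div_iff this hx, mul_comm, Complex.mul_conj, Complex.normSq_eq_norm_sq]
    push_cast; ring

lemma eCircConj_eq (l : ℤ) : eCircConj l = eCirc (-l) := by
  funext z
  unfold eCircConj eCirc
  rw [map_div₀, Complex.conj_ofReal, map_zpow₀, zpow_neg, ← inv_zpow, ← Circle.coe_inv_eq_conj,
    Circle.coe_inv]

lemma eCirc_eq (m : ℤ) (z : Circle) :
    eCirc m z = solidHarmonic m z / (Real.sqrt (2 * Real.pi) : ℂ) := by
  rw [← pow_mul_eHom, eHom, Circle.norm_coe, eCirc]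
  simp

lemma phi_neg (κ : ℝ) (l : ℤ) (r : ℝ) : phi κ (-l) r = phi κ l r := by
  simp [phi]

/-- The radial profile of `φ^κ_m e_m` in the variable `s = r²`, without the factor `r^|m|`. -/
def schrodingerProfile (κ : ℝ) (m : ℤ) (s : ℝ) : ℝ :=
  1 / (besselB m.natAbs κ * Real.sqrt (2 * Real.pi)) * besselB m.natAbs (κ * s)

lemma contDiff_schrodingerProfile (κ : ℝ) (m : ℤ) : ContDiff ℝ ∞ (schrodingerProfile κ m) :=
  contDiff_const.mul (contDiff_besselB_mul _ κ)

lemma separated_schrodingerProfile {κ : ℝ} (hκ : κ < besselZero ^ 2) (m : ℤ) (x : ℂ) :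
    separated m (schrodingerProfile κ m) x = phi κ m ‖x‖ * eHom m x := by
  rw [phi_eq hκ, mul_right_comm, pow_mul_eHom, separated, schrodingerProfile,
    Complex.normSq_eq_norm_sq]
  push_cast
  ring

/-- The explicit solution of `-Δv = κ v` with boundary values `e_m`. -/
def schrodingerMode (κ : ℝ) (m : ℤ) : H1 :=
  smoothH1 (separated m (schrodingerProfile κ m))
    (contDiff_separated m (contDiff_schrodingerProfile κ m))

theorem isFormSol_schrodingerMode {κ : ℝ} (hκ : κ < besselZero ^ 2) (m : ℤ) :
    IsFormSol (fun _ => 1) (fun _ => -κ) (eCirc m) (schrodingerMode κ m) := by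
  refine isFormSol_separated m (W := fun _ => 1) (contDiff_schrodingerProfile κ m) contDiff_const
    (fun s _ => ?_) fun z => ?_
  · have d1 : deriv (schrodingerProfile κ m) = fun s =>
        1 / (besselB m.natAbs κ * Real.sqrt (2 * Real.pi))
          * (-(κ / 4) * besselB (m.natAbs + 1) (κ * s)) :=
      funext fun s => ((hasDerivAt_besselB_mul m.natAbs κ s).const_mul _).deriv
    have d2 := (((hasDerivAt_besselB_mul (m.natAbs + 1) κ s).const_mul (-(κ / 4))).const_mul
      (1 / (besselB m.natAbs κ * Real.sqrt (2 * Real.pi)))).deriv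
    rw [← d1] at d2
    rw [d2, d1, deriv_const]
    simp only [schrodingerProfile]
    have hrec := besselB_rec m.natAbs (κ * s)
    linear_combination (κ * (1 / (besselB m.natAbs κ * Real.sqrt (2 * Real.pi)))) * hrec
  · rw [eCirc_eq, separated, Complex.normSq_eq_norm_sq, Circle.norm_coe, schrodingerProfile, one_pow,
      mul_one]
    have hB : (besselB m.natAbs κ : ℂ) ≠ 0 := by exact_mod_cast (besselB_pos_at m.natAbs hκ).ne'
    have := sqrt_two_pi_ne_zero
    push_cast
    field_simp

/-- The radial profile of the solution `J₀(√κ) φ^κ_m e_m / J₀(√κ |x|)` of the conductivity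
equation, in the variable `s = r²` and without the factor `r^|m|`; here `P` extends
`s ↦ J₀(√κ √s)` from `[0, 1]` to a positive function on the line. -/
def condProfile (κ : ℝ) (P : ℝ → ℝ) (m : ℤ) (s : ℝ) : ℝ :=
  besselB 0 κ / (besselB m.natAbs κ * Real.sqrt (2 * Real.pi)) * besselB m.natAbs (κ * s) / P s

section Conductivity

variable {κ : ℝ} {P : ℝ → ℝ}

lemma contDiff_condProfile (hP : ContDiff ℝ ∞ P) (hpos : ∀ s, 0 < P s) (m : ℤ) :
    ContDiff ℝ ∞ (condProfile κ P m) :=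
  (contDiff_const.mul (contDiff_besselB_mul _ κ)).div hP fun s => (hpos s).ne'

lemma deriv_condProfile (hP : ContDiff ℝ ∞ P) (hpos : ∀ s, 0 < P s) (m : ℤ) :
    deriv (condProfile κ P m) = fun s =>
      besselB 0 κ / (besselB m.natAbs κ * Real.sqrt (2 * Real.pi))
        * (-(κ / 4) * besselB (m.natAbs + 1) (κ * s) * P s
          - besselB m.natAbs (κ * s) * deriv P s) / P s ^ 2 := by
  funext s
  have h := ((hasDerivAt_besselB_mul m.natAbs κ s).const_mul
    (besselB 0 κ / (besselB m.natAbs κ * Real.sqrt (2 * Real.pi)))).div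
    ((hP.differentiable (by simp) s).hasDerivAt) (hpos s).ne'
  refine h.deriv.trans ?_
  ring

/-- The explicit solution of `∇·(σ_κ ∇u) = 0` with boundary values `e_m`. -/
def condMode (κ : ℝ) (hP : ContDiff ℝ ∞ P) (hpos : ∀ s, 0 < P s) (m : ℤ) : H1 :=
  smoothH1 (separated m (condProfile κ P m)) (contDiff_separated m (contDiff_condProfile hP hpos m))

variable (hP : ContDiff ℝ ∞ P) (hpos : ∀ s, 0 < P s)
  (hPB : ∀ s ∈ Set.Icc (0 : ℝ) 1, P =ᶠ[𝓝 s] fun s => besselB 0 (κ * s))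

lemma IsFormSol.congr {γ γ' q : ℂ → ℝ} (h : ∀ x ∈ disk, γ x = γ' x) {g : Circle → ℂ} {u : H1}
    (hu : IsFormSol γ q g u) : IsFormSol γ' q g u := by
  refine ⟨hu.1, fun w hw => ?_⟩
  rw [← hu.2 w hw]
  refine integral_congr_ae ?_
  filter_upwards [ae_mem_disk] with x hx
  rw [h x hx]

include hPB in
theorem isFormSol_condMode (hκ : κ < besselZero ^ 2) (m : ℤ) :
    IsFormSol (sigma κ) (fun _ => 0) (eCirc m) (condMode κ hP hpos m) := by
  refine IsFormSol.congr (γ := fun x => P (Complex.normSq x) ^ 2) (fun x hx => ?_)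
    (isFormSol_separated m (W := fun s => P s ^ 2) (contDiff_condProfile hP hpos m) (hP.pow 2)
    (fun s hs => ?_) fun z => ?_)
  · rw [sigma_eq, (hPB _ ⟨Complex.normSq_nonneg x, (normSq_lt_one hx).le⟩).self_of_nhds]
  · obtain ⟨e0, e1, e2⟩ := hasDerivAt_of_eventuallyEq_besselB (hPB s ⟨hs.1, hs.2.le⟩)
    have hP1 := (hP.differentiable (by simp) s).hasDerivAt
    set c := besselB 0 κ / (besselB m.natAbs κ * Real.sqrt (2 * Real.pi)) with hc
    have d1 := deriv_condProfile (κ := κ) hP hpos m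
    have dW : deriv (fun s => P s ^ 2) s = 2 * P s * deriv P s :=
      Eq.trans (b := _) (hP1.pow 2).deriv (by norm_num)
    have b1 := hasDerivAt_besselB_mul m.natAbs κ s
    have b2 := (hasDerivAt_besselB_mul (m.natAbs + 1) κ s).const_mul (-(κ / 4))
    have d2 := ((((b2.mul hP1).sub (b1.mul e2)).const_mul c).div (hP1.pow 2)
      (pow_ne_zero 2 (hpos s).ne')).deriv
    rw [(congrArg (fun f => deriv f s) d1).trans d2, dW, d1, e1]
    simp only [condProfile, ← hc, Pi.mul_apply, Pi.sub_apply, Pi.pow_apply]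
    have hPs := (hpos s).ne'
    have hr0 := besselB_rec 0 (κ * s)
    have hrn := besselB_rec m.natAbs (κ * s)
    rw [e1]
    rw [← e0] at hr0
    push_cast at hr0
    simp only [zero_add] at hr0 ⊢
    clear d2 e0 e1 e2 b1 b2
    clear_value c
    generalize besselB m.natAbs (κ * s) = b at *
    generalize besselB (m.natAbs + 1) (κ * s) = b₁ at *
    generalize besselB (m.natAbs + 1 + 1) (κ * s) = b₂ at *
    generalize besselB 1 (κ * s) = p₁ at *
    generalize besselB 2 (κ * s) = p₂ at *
    field_simp
    linear_combination (-(4 * κ * c * P s ^ 2) * b) * hr0 + (4 * κ * c * P s ^ 3) * hrn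
  · have hP1 : P 1 = besselB 0 κ := by simpa using (hPB 1 ⟨zero_le_one, le_rfl⟩).self_of_nhds
    rw [eCirc_eq, separated, Complex.normSq_eq_norm_sq, Circle.norm_coe, condProfile, one_pow,
      mul_one, hP1]
    have hB : (besselB m.natAbs κ : ℂ) ≠ 0 := by exact_mod_cast (besselB_pos_at m.natAbs hκ).ne'
    have hB0 : (besselB 0 κ : ℂ) ≠ 0 := by exact_mod_cast (besselB_pos_at 0 hκ).ne'
    have := sqrt_two_pi_ne_zero
    push_cast
    field_simp

end Conductivity

/-- Splitting gradients into radial and angular parts. -/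
lemma normSq_mul_gradient_product (l m : ℤ) (A B : ℝ → ℝ) (x : ℂ) :
    (Complex.normSq x : ℂ) * (separatedDeriv l A 1 x * separatedDeriv m B 1 x
        + separatedDeriv l A Complex.I x * separatedDeriv m B Complex.I x)
      = ((2 * Complex.normSq x * ((deriv A (Complex.normSq x) : ℝ) : ℂ)
            + l.natAbs * (A (Complex.normSq x) : ℂ))
          * (2 * Complex.normSq x * ((deriv B (Complex.normSq x) : ℝ) : ℂ)
            + m.natAbs * (B (Complex.normSq x) : ℂ))
          - l * m * (A (Complex.normSq x) : ℂ) * (B (Complex.normSq x) : ℂ))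
        * (solidHarmonic l x * solidHarmonic m x) := by
  have hl1 : ∀ m, twist m 1 = 1 := fun m => by simp [twist]
  have hlI : ∀ m, twist m Complex.I = orient m * Complex.I := fun m => by simp [twist]
  have hsx : (Complex.normSq x : ℂ) = x.re * x.re + x.im * x.im := by
    rw [Complex.normSq_apply]; push_cast; ring
  -- the derivatives in the directions `x` and `i x`
  have key : ∀ (m : ℤ) (A : ℝ → ℝ),
      x.re * separatedDeriv m A 1 x + x.im * separatedDeriv m A Complex.I x
        = (2 * Complex.normSq x * ((deriv A (Complex.normSq x) : ℝ) : ℂ)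
            + m.natAbs * (A (Complex.normSq x) : ℂ)) * solidHarmonic m x ∧
      x.re * separatedDeriv m A Complex.I x - x.im * separatedDeriv m A 1 x
        = Complex.I * (m * (A (Complex.normSq x) : ℂ)) * solidHarmonic m x := by
    intro m A
    have heul := solidDeriv_mul_twist m x
    have ho := orient_sq m
    have hI := Complex.I_sq
    have hon := orient_mul_natAbs m
    rw [show twist m x = (x.re : ℂ) + orient m * Complex.I * (x.im : ℂ) from rfl] at heul
    simp only [separatedDeriv, hl1, hlI, Complex.one_re, Complex.one_im, Complex.I_re,
      Complex.I_im, mul_one, mul_zero, add_zero, zero_add, Complex.ofReal_mul, Complex.ofReal_ofNat]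
    rw [← hon, hsx]
    constructor
    · linear_combination (A (Complex.normSq x) : ℂ) * heul
    · linear_combination (A (Complex.normSq x) : ℂ) * (orient m * Complex.I) * heul
        - (A (Complex.normSq x) : ℂ) * solidDeriv m x * x.im * (orient m ^ 2 * hI - ho)
  obtain ⟨r1, t1⟩ := key l A
  obtain ⟨r2, t2⟩ := key m B
  have hI := Complex.I_sq
  have e : (Complex.normSq x : ℂ) * (separatedDeriv l A 1 x * separatedDeriv m B 1 x
        + separatedDeriv l A Complex.I x * separatedDeriv m B Complex.I x)
      = (x.re * separatedDeriv l A 1 x + x.im * separatedDeriv l A Complex.I x)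
          * (x.re * separatedDeriv m B 1 x + x.im * separatedDeriv m B Complex.I x)
        + (x.re * separatedDeriv l A Complex.I x - x.im * separatedDeriv l A 1 x)
          * (x.re * separatedDeriv m B Complex.I x - x.im * separatedDeriv m B 1 x) := by
    rw [hsx]; ring
  rw [e, r1, r2, t1, t2]
  linear_combination (l * m * (A (Complex.normSq x) : ℂ) * (B (Complex.normSq x) : ℂ)
    * solidHarmonic l x * solidHarmonic m x) * hI

/-! ### The moments as weighted integrals -/

lemma HasSmoothRep.congr {h₁ h₂ : ℂ → ℂ} (h : h₁ =ᵐ[diskVol] h₂) (H : HasSmoothRep h₁) :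
    HasSmoothRep h₂ := by
  obtain ⟨s, hs⟩ := H
  exact ⟨s, hs.trans h⟩

lemma CompactDistribution.toLin_eq_of_ae (T : CompactDistribution) {s t : smoothOn}
    (h : (s : ℂ → ℂ) =ᵐ[diskVol] (t : ℂ → ℂ)) : T.toLin s = T.toLin t := by
  have hs : ContDiffOn ℝ ∞ (s : ℂ → ℂ) disk := s.2
  have ht : ContDiffOn ℝ ∞ (t : ℂ → ℂ) disk := t.2
  have heq : Set.EqOn (s : ℂ → ℂ) t disk :=
    Measure.eqOn_open_of_ae_eq h isOpen_disk hs.continuousOn ht.continuousOn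
  obtain ⟨K, _, hK, k, C, hC⟩ := T.bounded
  have := hC (s - t) 0 fun j _ x hx => by
    have hz : ((s - t : smoothOn) : ℂ → ℂ) =ᶠ[𝓝 x] fun _ => 0 := by
      filter_upwards [isOpen_disk.mem_nhds (hK hx)] with y hy
      exact sub_eq_zero.2 (heq hy)
    rw [(hz.iteratedFDeriv ℝ j).self_of_nhds, iteratedFDeriv_fun_zero]
    simp
  rw [mul_zero] at this
  rw [← sub_eq_zero, ← map_sub]
  exact norm_le_zero_iff.1 this

/-- The pairing with a distribution depends only on the almost everywhere class. -/
lemma CompactDistribution.pair_congr (T : CompactDistribution) {h₁ h₂ : ℂ → ℂ}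
    (h : h₁ =ᵐ[diskVol] h₂) : T.pair h₁ = T.pair h₂ := by
  unfold CompactDistribution.pair
  by_cases H : HasSmoothRep h₁
  · have H' := H.congr h
    rw [dif_pos H, dif_pos H']
    exact T.toLin_eq_of_ae ((H.choose_spec.trans h).trans H'.choose_spec.symm)
  · have H' : ¬ HasSmoothRep h₂ := fun H' => H (H'.congr h.symm)
    rw [dif_neg H, dif_neg H']

lemma pairingDefined_of_ae {F K S : ℂ → ℂ} (hF : MemLp F ∞ diskVol) (hS : ContDiff ℝ ∞ S)
    (h : S =ᵐ[diskVol] K) : PairingDefined F K := by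
  refine ⟨?_, ⟨S, hS.contDiffOn⟩, h⟩
  have h1 : Integrable (F * S) diskVol :=
    hF.integrable_mul (memLp_diskVol hS.continuous 1)
  refine h1.congr ?_
  filter_upwards [h] with x hx
  rw [Pi.mul_apply, hx]

lemma memLp_re {F : ℂ → ℂ} (hF : MemLp F ∞ diskVol) : MemLp (fun x => (F x).re) ∞ diskVol := hF.re

lemma memLp_im {F : ℂ → ℂ} (hF : MemLp F ∞ diskVol) : MemLp (fun x => (F x).im) ∞ diskVol := hF.im

lemma integral_re_add_im {F G : ℂ → ℂ} (hF : MemLp F ∞ diskVol) (hG : Integrable G diskVol) :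
    (∫ x, ((F x).re : ℂ) * G x ∂diskVol) + Complex.I * ∫ x, ((F x).im : ℂ) * G x ∂diskVol
      = ∫ x, F x * G x ∂diskVol := by
  have hG1 := memLp_one_iff_integrable.2 hG
  have hre : MemLp (fun x => ((F x).re : ℂ)) ∞ diskVol := (memLp_re hF).ofReal
  have him : MemLp (fun x => ((F x).im : ℂ)) ∞ diskVol := (memLp_im hF).ofReal
  have i1 : Integrable (fun x => ((F x).re : ℂ) * G x) diskVol := hre.integrable_mul hG1
  have i2 : Integrable (fun x => ((F x).im : ℂ) * G x) diskVol := him.integrable_mul hG1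
  rw [← integral_const_mul, ← integral_add i1 (i2.const_mul _)]
  congr 1
  funext x
  conv_rhs => rw [← Complex.re_add_im (F x)]
  ring

lemma memHHalf_eCirc (m : ℤ) : MemHHalf (eCirc m) := by
  refine ⟨_, hasTrace_smooth ((contDiff_solidHarmonic m).mul
    (contDiff_const (c := ((Real.sqrt (2 * Real.pi) : ℂ))⁻¹))) fun z => ?_⟩
  rw [eCirc_eq, div_eq_mul_inv]

lemma memHHalf_eCircConj (l : ℤ) : MemHHalf (eCircConj l) := by
  rw [eCircConj_eq]
  exact memHHalf_eCirc (-l)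

/-- The Schrödinger weight is the product of the explicit solutions. -/
lemma muKernel_eq {κ : ℝ} (hκ : κ < besselZero ^ 2) (l m : ℤ) (x : ℂ) :
    muKernel κ l m x
      = separated (-l) (schrodingerProfile κ (-l)) x * separated m (schrodingerProfile κ m) x := by
  rw [separated_schrodingerProfile hκ, separated_schrodingerProfile hκ, phi_neg, muKernel,
    conj_eHom]
  ring

/-- The weighted integral and distributional pairing computed by `dΦ^S` at `-κ`. -/
theorem dPhiS_eq_integralPair {κ : ℝ} (hκ : κ < besselZero ^ 2) {F : ℂ → ℂ}
    (hF : MemLp F ∞ diskVol) (T : CompactDistribution) (l m : ℤ) :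
    PairingDefined F (muKernel κ l m) ∧
      dPhiS (fun _ => -κ) F T (eCircConj l) (eCirc m) = integralPair F T (muKernel κ l m) := by
  have hl := isFormSol_schrodingerMode hκ (-l)
  have hm := isFormSol_schrodingerMode hκ m
  have hc := isCoerciveForm_schrodinger hκ
  have hsm : ContDiff ℝ ∞ fun x => separated (-l) (schrodingerProfile κ (-l)) x
      * separated m (schrodingerProfile κ m) x :=
    (contDiff_separated _ (contDiff_schrodingerProfile κ _)).mul
      (contDiff_separated _ (contDiff_schrodingerProfile κ _))
  have hK : (fun x => separated (-l) (schrodingerProfile κ (-l)) x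
      * separated m (schrodingerProfile κ m) x) = muKernel κ l m :=
    funext fun x => (muKernel_eq hκ l m x).symm
  have hint : Integrable (fun x => (schrodingerMode κ (-l)).val x * (schrodingerMode κ m).val x)
      diskVol := (schrodingerMode κ (-l)).val_mem.integrable_mul (schrodingerMode κ m).val_mem
  refine ⟨pairingDefined_of_ae hF hsm (hK ▸ EventuallyEq.rfl), ?_⟩
  rw [eCircConj_eq, dPhiS, dPhiSReal_eq hc (memLp_re hF) hl hm, dPhiSReal_eq hc (memLp_im hF) hl hm,
    integral_re_add_im hF hint, integralPair]
  congr 1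
  · rw [← hK]
    rfl
  · refine T.pair_congr ?_
    obtain ⟨v1, _⟩ := jet_eq_iff.1 (hc.jet_eq (schrodingerSol_spec ⟨_, hl⟩) hl)
    obtain ⟨v2, _⟩ := jet_eq_iff.1 (hc.jet_eq (schrodingerSol_spec ⟨_, hm⟩) hm)
    rw [← hK]
    filter_upwards [v1, v2] with x h1 h2
    rw [h1, h2]
    rfl

lemma memLp_sigma (κ : ℝ) : MemLp (sigma κ) ∞ diskVol := by
  have h : sigma κ = fun x => besselB 0 (κ * Complex.normSq x) ^ 2 := funext (sigma_eq κ)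
  have hc : ContDiff ℝ ∞ fun s : ℝ => besselB 0 (κ * s) ^ 2 := (contDiff_besselB_mul 0 κ).pow 2
  rw [h]
  exact (memLp_diskVol (contDiff_radial hc).continuous ∞).re

lemma exists_sigma_lower_bound {κ : ℝ} (hκ : κ < besselZero ^ 2) :
    ∃ c : ℝ, 0 < c ∧ ∀ᵐ x ∂diskVol, c ≤ sigma κ x := by
  obtain ⟨t, ht, hmin⟩ := isCompact_Icc.exists_isMinOn (Set.nonempty_Icc.2 (zero_le_one' ℝ))
    (contDiff_besselB_mul 0 κ).continuous.continuousOn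
  have hpos := besselB_mul_pos 0 hκ ht.1 ht.2
  refine ⟨besselB 0 (κ * t) ^ 2, by positivity, ?_⟩
  filter_upwards [ae_mem_disk] with x hx
  rw [sigma_eq]
  exact pow_le_pow_left₀ hpos.le (hmin ⟨Complex.normSq_nonneg x, (normSq_lt_one hx).le⟩) 2

lemma isCoerciveForm_sigma {κ : ℝ} (hκ : κ < besselZero ^ 2) :
    IsCoerciveForm (sigma κ) (fun _ => 0) (memLp_sigma κ) (memLp_const_real 0) := by
  obtain ⟨c, hc, h⟩ := exists_sigma_lower_bound hκ
  exact isCoerciveForm_conductivity (memLp_sigma κ) hc h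

section Conductivity

variable {κ : ℝ} {P : ℝ → ℝ} (hP : ContDiff ℝ ∞ P) (hpos : ∀ s, 0 < P s)
  (hPB : ∀ s ∈ Set.Icc (0 : ℝ) 1, P =ᶠ[𝓝 s] fun s => besselB 0 (κ * s))

lemma gradDot_condMode (l m : ℤ) (x : ℂ) :
    gradDot (condMode κ hP hpos l) (condMode κ hP hpos m) x
      = separatedDeriv l (condProfile κ P l) 1 x * separatedDeriv m (condProfile κ P m) 1 x
        + separatedDeriv l (condProfile κ P l) Complex.I x
          * separatedDeriv m (condProfile κ P m) Complex.I x := by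
  simp only [gradDot, condMode, smoothH1, fderiv_separated _ (contDiff_condProfile hP hpos _)]

lemma contDiff_gradDot_condMode (l m : ℤ) :
    ContDiff ℝ ∞ (gradDot (condMode κ hP hpos l) (condMode κ hP hpos m)) := by
  have h : gradDot (condMode κ hP hpos l) (condMode κ hP hpos m) = _ :=
    funext (gradDot_condMode hP hpos l m)
  rw [h]
  exact ((contDiff_separatedDeriv l (contDiff_condProfile hP hpos l) 1).mul
    (contDiff_separatedDeriv m (contDiff_condProfile hP hpos m) 1)).add
    ((contDiff_separatedDeriv l (contDiff_condProfile hP hpos l) Complex.I).mul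
    (contDiff_separatedDeriv m (contDiff_condProfile hP hpos m) Complex.I))

include hP hpos hPB in
/-- The logarithmic radial derivative of the profile of the conductivity solution is `ψ`. -/
lemma two_mul_deriv_condProfile (hκ : κ < besselZero ^ 2) (m : ℤ) {x : ℂ} (hx : x ∈ disk) :
    2 * (Complex.normSq x : ℂ) * ((deriv (condProfile κ P m) (Complex.normSq x) : ℝ) : ℂ)
      = psi κ m ‖x‖ * (condProfile κ P m (Complex.normSq x) : ℂ) := by
  have hs1 := (normSq_lt_one hx).le
  have hs0 := Complex.normSq_nonneg x
  obtain ⟨e0, e1, -⟩ := hasDerivAt_of_eventuallyEq_besselB (hPB _ ⟨hs0, hs1⟩)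
  rw [psi_eq hκ m (norm_nonneg x) (mem_disk.1 hx).le, ← Complex.normSq_eq_norm_sq,
    deriv_condProfile hP hpos, condProfile]
  have hB0 := (besselB_mul_pos 0 hκ hs0 hs1).ne'
  have hBn := (besselB_mul_pos m.natAbs hκ hs0 hs1).ne'
  have hn := (besselB_pos_at m.natAbs hκ).ne'
  have hpi : Real.sqrt (2 * Real.pi) ≠ 0 := (Real.sqrt_pos.2 (by positivity)).ne'
  simp only [e0, e1]
  rw [← Complex.ofReal_ofNat, ← Complex.ofReal_mul, ← Complex.ofReal_mul, ← Complex.ofReal_mul]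
  congr 1
  simp only [zero_add]
  generalize besselB m.natAbs (κ * Complex.normSq x) = b at *
  generalize besselB (m.natAbs + 1) (κ * Complex.normSq x) = b₁ at *
  generalize besselB 0 (κ * Complex.normSq x) = p at *
  generalize besselB 1 (κ * Complex.normSq x) = p₁ at *
  field_simp
  ring

include hPB in
lemma condProfile_mul_solidHarmonic (hκ : κ < besselZero ^ 2) (m : ℤ) {x : ℂ} (hx : x ∈ disk) :
    (condProfile κ P m (Complex.normSq x) : ℂ) * solidHarmonic m x
      = (besselB 0 κ : ℂ) / (besselB 0 (κ * Complex.normSq x) : ℂ)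
        * (phi κ m ‖x‖ * eHom m x) := by
  have e0 := (hPB _ ⟨Complex.normSq_nonneg x, (normSq_lt_one hx).le⟩).self_of_nhds
  rw [phi_eq hκ, mul_right_comm ((‖x‖ : ℂ) ^ m.natAbs), pow_mul_eHom, condProfile,
    ← Complex.normSq_eq_norm_sq, e0]
  push_cast
  ring

include hPB in
/-- Away from the origin the explicit weight is the product of the gradients of the solutions. -/
lemma gradDot_eq_fmKernel (hκ : κ < besselZero ^ 2) (l m : ℤ) {x : ℂ} (hx : x ∈ disk)
    (hx0 : x ≠ 0) :
    gradDot (condMode κ hP hpos (-l)) (condMode κ hP hpos m) x = fmKernel κ l m x := by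
  have hs : (Complex.normSq x : ℂ) ≠ 0 := by exact_mod_cast (Complex.normSq_pos.2 hx0).ne'
  have key := normSq_mul_gradient_product (-l) m (condProfile κ P (-l)) (condProfile κ P m) x
  rw [← gradDot_condMode hP hpos] at key
  rw [two_mul_deriv_condProfile hP hpos hPB hκ (-l) hx,
    two_mul_deriv_condProfile hP hpos hPB hκ m hx] at key
  have hl := condProfile_mul_solidHarmonic hPB hκ (-l) hx
  have hm := condProfile_mul_solidHarmonic hPB hκ m hx
  have hpsi : psi κ (-l) ‖x‖ = psi κ l ‖x‖ := by simp [psi]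
  rw [phi_neg] at hl
  rw [hpsi, Int.natAbs_neg] at key
  have hB0 : (besselB 0 (κ * Complex.normSq x) : ℂ) ≠ 0 := by
    exact_mod_cast (besselB_mul_pos 0 hκ (Complex.normSq_nonneg x) (normSq_lt_one hx).le).ne'
  have hJ : besselJ 0 (sqrtC κ) = (besselB 0 κ : ℂ) := by
    rw [besselJ_eq_of_sq_eq 0 (sqrtC_sq κ), pow_zero, one_mul]
  have habs : ∀ k : ℤ, ((|k| : ℤ) : ℂ) = (k.natAbs : ℂ) := fun k => by
    rw [Int.abs_eq_natAbs, Int.cast_natCast]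
  have hnorm : (‖x‖ : ℂ) ^ 2 = (Complex.normSq x : ℂ) := by
    rw [Complex.normSq_eq_norm_sq]; push_cast; rfl
  refine mul_left_cancel₀ hs (key.trans ?_)
  rw [fmKernel, hJ, habs, habs, hnorm, sigma_eq, conj_eHom]
  have hexp : ((psi κ l ‖x‖ * (condProfile κ P (-l) (Complex.normSq x) : ℂ)
        + l.natAbs * (condProfile κ P (-l) (Complex.normSq x) : ℂ))
        * (psi κ m ‖x‖ * (condProfile κ P m (Complex.normSq x) : ℂ)
        + m.natAbs * (condProfile κ P m (Complex.normSq x) : ℂ))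
        - ((-l : ℤ) : ℂ) * m * (condProfile κ P (-l) (Complex.normSq x) : ℂ)
          * (condProfile κ P m (Complex.normSq x) : ℂ))
        * (solidHarmonic (-l) x * solidHarmonic m x)
      = ((l : ℂ) * m + (l.natAbs + psi κ l ‖x‖) * (m.natAbs + psi κ m ‖x‖))
        * (((condProfile κ P (-l) (Complex.normSq x) : ℂ) * solidHarmonic (-l) x)
          * ((condProfile κ P m (Complex.normSq x) : ℂ) * solidHarmonic m x)) := by
    push_cast
    ring
  rw [hexp, hl, hm]
  push_cast
  field_simp

end Conductivity

lemma ae_ne_zero_disk : ∀ᵐ x ∂diskVol, x ≠ 0 :=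
  ae_restrict_of_ae (compl_mem_ae_iff.2 (measure_singleton (0 : ℂ)))

/-- The weighted integral and distributional pairing computed by `dΦ` at `σ_κ`. -/
theorem fmMoment_eq_integralPair {κ : ℝ} (hκ : κ < besselZero ^ 2) {F : ℂ → ℂ}
    (hF : MemLp F ∞ diskVol) (T : CompactDistribution) (l m : ℤ) :
    PairingDefined F (fmKernel κ l m) ∧
      fmMoment κ l m F T = integralPair F T (fmKernel κ l m) := by
  obtain ⟨P, hP, hpos, hPB⟩ := exists_besselB_extension hκ
  have hl := isFormSol_condMode hP hpos hPB hκ (-l)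
  have hm := isFormSol_condMode hP hpos hPB hκ m
  have hc := isCoerciveForm_sigma hκ
  have hK : gradDot (condMode κ hP hpos (-l)) (condMode κ hP hpos m)
      =ᵐ[diskVol] fmKernel κ l m := by
    filter_upwards [ae_mem_disk, ae_ne_zero_disk] with x hx hx0
    exact gradDot_eq_fmKernel hP hpos hPB hκ l m hx hx0
  have hint : Integrable (gradDot (condMode κ hP hpos (-l)) (condMode κ hP hpos m)) diskVol :=
    ((condMode κ hP hpos (-l)).d1_mem.integrable_mul (condMode κ hP hpos m).d1_mem).add
      ((condMode κ hP hpos (-l)).d2_mem.integrable_mul (condMode κ hP hpos m).d2_mem)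
  refine ⟨pairingDefined_of_ae hF (contDiff_gradDot_condMode hP hpos (-l) m) hK, ?_⟩
  rw [fmMoment, eCircConj_eq, dPhi, dPhiReal_eq hc (memLp_re hF) hl hm,
    dPhiReal_eq hc (memLp_im hF) hl hm, integral_re_add_im hF hint, integralPair]
  congr 1
  · refine integral_congr_ae ?_
    filter_upwards [hK] with x hx
    rw [hx]
  · refine T.pair_congr (EventuallyEq.trans ?_ hK)
    obtain ⟨-, a1, a2⟩ := jet_eq_iff.1 (hc.jet_eq (condSol_spec ⟨_, hl⟩) hl)
    obtain ⟨-, b1, b2⟩ := jet_eq_iff.1 (hc.jet_eq (condSol_spec ⟨_, hm⟩) hm)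
    filter_upwards [a1, a2, b1, b2] with x h1 h2 h3 h4
    rw [gradDot, gradDot, h1, h2, h3, h4]

end DiskBorn

end

theorem mainTheorem6 (κ : ℝ) (hκ : κ < DiskBorn.besselZero ^ 2) :
    -- the moments of every element `F + T` of `L^∞ + 𝓔'` are given by the explicit formula
    (∀ (F : ℂ → ℂ) (T : DiskBorn.CompactDistribution), MemLp F ∞ DiskBorn.diskVol →
      ∀ l m : ℤ, DiskBorn.PairingDefined F (DiskBorn.fmKernel κ l m) ∧
        DiskBorn.fmMoment κ l m F T = DiskBorn.integralPair F T (DiskBorn.fmKernel κ l m)) ∧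
    -- Born approximations `F + T` of `γ` in `W^{2,∞} + 𝓔'` solve the moment problem
    (∀ (γ : ℂ → ℝ) (a : ℝ), DiskBorn.IsConductivity γ →
      DiskBorn.MemSobolev ∞ 2 (fun x => (γ x : ℂ)) → 0 < a →
      (∃ u : DiskBorn.H1, u.val =ᵐ[DiskBorn.diskVol] (fun x => (γ x : ℂ)) ∧
        DiskBorn.HasTrace u (fun z => ((a * DiskBorn.sigma κ (z : ℂ) : ℝ) : ℂ))) →
      ∀ (F : ℂ → ℂ) (T : DiskBorn.CompactDistribution), DiskBorn.MemSobolev ∞ 2 F →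
        DiskBorn.IsBornApprox (DiskBorn.sigma κ) γ F T →
        ∀ l m : ℤ,
          DiskBorn.fmMoment κ l m F T
            = DiskBorn.DtN γ (DiskBorn.eCircConj l) (DiskBorn.eCirc m) ∧
          DiskBorn.integralPair F T (DiskBorn.fmKernel κ l m)
            = DiskBorn.DtN γ (DiskBorn.eCircConj l) (DiskBorn.eCirc m)) ∧
    -- Born approximations `Q + T` of `q` at `-κ` in `L^∞ + 𝓔'` solve the moment problem
    (∀ q : ℂ → ℝ, MemLp q ∞ DiskBorn.diskVol → DiskBorn.ZeroNotInSpectrum q →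
      ∀ (Q : ℂ → ℂ) (T : DiskBorn.CompactDistribution), MemLp Q ∞ DiskBorn.diskVol →
        DiskBorn.IsBornApproxS (fun _ => -κ) q Q T →
        ∀ l m : ℤ,
          DiskBorn.PairingDefined (fun x => Q x + (κ : ℂ)) (DiskBorn.muKernel κ l m) ∧
          DiskBorn.muMoment κ l m (fun x => Q x + (κ : ℂ)) T
            = DiskBorn.DtNS q (DiskBorn.eCircConj l) (DiskBorn.eCirc m)
              - DiskBorn.DtNS (fun _ => -κ) (DiskBorn.eCircConj l) (DiskBorn.eCirc m)) := by
  refine ⟨fun F T hF l m => DiskBorn.fmMoment_eq_integralPair hκ hF T l m, ?_, ?_⟩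
  · intro γ a _ _ _ _ F T hF hB l m
    have h := hB _ _ (DiskBorn.memHHalf_eCircConj l) (DiskBorn.memHHalf_eCirc m)
    exact ⟨h, (DiskBorn.fmMoment_eq_integralPair hκ hF.1 T l m).2.symm.trans h⟩
  · intro q _ _ Q T hQ hB l m
    have hF : MemLp (fun x => Q x + (κ : ℂ)) ∞ DiskBorn.diskVol := hQ.add (memLp_const _)
    obtain ⟨h1, h2⟩ := DiskBorn.dPhiS_eq_integralPair hκ hF T l m
    have h := hB _ _ (DiskBorn.memHHalf_eCircConj l) (DiskBorn.memHHalf_eCirc m)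
    simp only [Complex.ofReal_neg, sub_neg_eq_add] at h
    exact ⟨h1, h2.symm.trans h⟩
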